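/- **Model.** Let $\mathcal T=[\tau]$ be the set of classes and $\mathcal Y=\mathcal T\cup\{\xi\}$ the response alphabet ($\xi$ is a null response). There are $\ell$ objects with labels $T_1,\dots,T_\ell$ that are i.i.d. with an unknown law $P_T$ on $\mathcal T$. For a sequence of labels $t=(t_1,\dots,t_\ell)$ let $\mathcal N_i=\{i-1\}\cup\{\max\{k<i: t_k=t_i\}\}$ (absent indices are omitted). A worker with memory who is shown objects with labels $t$ answers $y\in\mathcal Y^\ell$ with probability $\prod_{i=1}^{\ell} Q(y_i\mid y_{\mathcal N_i},t_i)$; the pmf $Q(\cdot\mid y_{\mathcal N_i},t_i)$ may depend on which elements of $\mathcal N_i$ are present and whether they coincide. A worker pool is a probability law on such workers whose averaged response law $\bar Q(y\mid t)$ is again of this form; workers are drawn from it independently. Neither the pool nor $P_T$ is known. The memory quality of a pool at $t$ is $$\theta_m(t)=\tfrac12\Bigl(\min_i I(Y_i;Y_{\mathcal N_i})-\max_{i,\;j<i,\;j\notin\mathcal N_i} I(Y_i;Y_{i-1},Y_j)\Bigr)\quad\text{under } \bar Q(\cdot\mid t),$$ where $i$ runs over the indices with $|\mathcal N_i|=2$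 (the class of $i$ occurred before, but its most recent occurrence is not $i-1$), and $\theta_m=\min_t\theta_m(t)$ over the $t\in[\tau]^\ell$ for which some such pair $(i,j)$ exists. A universal decoder $\Phi$, given a budget of $N$ responses per object, shows the objects in $k$ independent uniformly random orders, each order to $n$ fresh workers, with $kn\le N$, and maps the orders and the responses to a partition of $[\ell]$; it errs if this is not the partition into classes of equal label. Let $N_\Phi(\epsilon,\theta)$ be the least $N$ for which the error probability is less than $\epsilon$ for all $P_T$ and all pools with $\theta_m\ge\theta$, and let $N^*_{\rm mem}(\epsilon,\theta)=\min_\Phi N_\Phi(\epsilon,\theta)$. **Statement.** There is an absolute constant $K$ such that for every $\tau\ge1$: 1. Let $0<\alpha<1/2$, $0<\beta<1$ with $2\alpha+\beta<1$ or $4\alpha<1$, and let $$e=\min\Bigl\{\frac1{1-2\alpha-\beta},\frac1{1-4\alpha}\Bigr\},$$ where only the terms with positive denominator are counted. There is $C>0$, depending only on $\tau,\alpha,\beta$, such that for all $\ell\ge K\tau^2$ and $0<\epsilon<1$ there is a universal decoder $\Phi$ with, for all $\theta>0$, $$N^*_{\rm mem}(\epsilon,\theta)\le N_\Phi(\epsilon,\theta)\le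 C\,\frac{(\log\ell-\log\epsilon)^{e}}{\theta^{2/(1-\beta)}}.$$ 2. There is $C>0$, depending only on $\tau$, such that for every $0<\epsilon<1$ and all $\ell\ge\ell_0(\tau,\epsilon)$ there is a universal decoder $\Phi$ with, for all $\theta>0$, $$N^*_{\rm mem}(\epsilon,\theta)\le N_\Phi(\epsilon,\theta)\le C\,\frac{\log\ell}{\theta^{2}}.$$ -/

import Mathlib

noncomputable section

namespace CrowdClustering

/-- The alphabet of responses: one of the `τ` labels, or `none`, the null response. -/
abbrev Response (τ : ℕ) : Type := Option (Fin τ)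

/-- What a worker with memory conditions the response to the current object on, namely the
responses to the neighbours of that object: the immediately preceding object and the most recent
object of the same class. -/
inductive Context (τ : ℕ) : Type where
  /-- the current object is the first one of the sequence, there is no neighbour -/
  | start : Context τ
  /-- no earlier object has the class of the current one; `prev` answers the preceding object -/
  | fresh (prev : Response τ) : Context τ
  /-- the preceding object has the class of the current one, and `prev` is its response -/
  | repeated (prev : Response τ) : Context τ
  /-- `prev` answers the preceding object, which is of another class, and `same` answers the most
  recent object of the same class -/
  | both (prev same : Response τ) : Context τ

/-- A worker with memory: for each class of the current object and each context, the pmf of the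
response. -/
structure MemoryKernel (τ : ℕ) where
  /-- `prob t c y` is the probability of the response `y` -/
  prob : Fin τ → Context τ → Response τ → ℝ
  isPmf : ∀ t c, prob t c ∈ stdSimplex ℝ (Response τ)

/-- The earlier positions with the same class as position `i`. -/
def sameBefore {τ ℓ : ℕ} (t : Fin ℓ → Fin τ) (i : Fin ℓ) : Finset (Fin ℓ) :=
  Finset.univ.filter fun k => k < i ∧ t k = t i

/-- The neighbours of position `i`: the preceding position, and the most recent position of the
same class. -/
def neighbors {τ ℓ : ℕ} (t : Fin ℓ → Fin τ) (i : Fin ℓ) : Finset (Fin ℓ) :=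
  Finset.univ.filter fun k =>
    (k : ℕ) + 1 = i ∨ (k ∈ sameBefore t i ∧ ∀ m ∈ sameBefore t i, m ≤ k)

/-- The context at position `i` of a worker who sees the label sequence `t` and answers `y`. -/
def context {τ ℓ : ℕ} (t : Fin ℓ → Fin τ) (y : Fin ℓ → Response τ) (i : Fin ℓ) : Context τ :=
  if (i : ℕ) = 0 then .start
  else
    let p : Fin ℓ := ⟨(i : ℕ) - 1, by omega⟩
    if h : (sameBefore t i).Nonempty then
      if (sameBefore t i).max' h = p then .repeated (y p)
      else .both (y p) (y ((sameBefore t i).max' h))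
    else .fresh (y p)

/-- The probability that a worker answers `y` to a sequence of objects with labels `t`. -/
def MemoryKernel.responseLaw {τ : ℕ} (Q : MemoryKernel τ) {ℓ : ℕ} (t : Fin ℓ → Fin τ)
    (y : Fin ℓ → Response τ) : ℝ :=
  ∏ i, Q.prob (t i) (context t y i) (y i)

/-- A pool of workers with memory. Workers are drawn independently from `law`; the response law of
a random worker again has the Markov memory structure. -/
structure WorkerPool (τ ℓ : ℕ) where
  Worker : Type
  [measurableSpace : MeasurableSpace Worker]
  law : MeasureTheory.Measure Worker
  [isProbabilityMeasure : MeasureTheory.IsProbabilityMeasure law]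
  kernel : Worker → MemoryKernel τ
  measurable_kernel : ∀ t c y, Measurable fun w => (kernel w).prob t c y
  markov_mean : ∃ Q : MemoryKernel τ, ∀ (t : Fin ℓ → Fin τ) (y : Fin ℓ → Response τ),
    ∫ w, (kernel w).responseLaw t y ∂law = Q.responseLaw t y

/-- The response law of a random worker of the pool, given the label sequence `t`. -/
def WorkerPool.meanLaw {τ ℓ : ℕ} (W : WorkerPool τ ℓ) (t : Fin ℓ → Fin τ)
    (y : Fin ℓ → Response τ) : ℝ :=
  letI := W.measurableSpace
  ∫ w, (W.kernel w).responseLaw t y ∂W.law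

/-- The pmf of the coordinates in `A` when the whole vector has pmf `p`. -/
def marginal {τ ℓ : ℕ} (p : (Fin ℓ → Response τ) → ℝ) (A : Finset (Fin ℓ))
    (z : A → Response τ) : ℝ :=
  ∑ y with (∀ a : A, y a = z a), p y

/-- The Shannon entropy (in nats) of the coordinates in `A`. -/
def entropy {τ ℓ : ℕ} (p : (Fin ℓ → Response τ) → ℝ) (A : Finset (Fin ℓ)) : ℝ :=
  ∑ z : A → Response τ, Real.negMulLog (marginal p A z)

/-- The mutual information between coordinate `i` and the coordinates in `S`. -/
def mutualInfo {τ ℓ : ℕ} (p : (Fin ℓ → Response τ) → ℝ) (i : Fin ℓ) (S : Finset (Fin ℓ)) : ℝ :=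
  entropy p {i} + entropy p S - entropy p (insert i S)

/-- The positions at which there is a parent to identify: the class of `i` occurred before, and
its most recent occurrence is not the preceding position, so that `i` has two neighbours. -/
abbrev Linked {τ ℓ : ℕ} (t : Fin ℓ → Fin τ) : Type :=
  {i : Fin ℓ // (neighbors t i).card = 2}

/-- The positions `(i, h, j)` with `i` as above, `h` the position just before `i`, and `j` an
earlier position that is not a neighbour of `i`. -/
abbrev Rival {τ ℓ : ℕ} (t : Fin ℓ → Fin τ) : Type :=
  {x : Fin ℓ × Fin ℓ × Fin ℓ // (neighbors t x.1).card = 2 ∧ (x.2.1 : ℕ) + 1 = x.1 ∧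
    x.2.2 < x.1 ∧ x.2.2 ∉ neighbors t x.1}

/-- The memory quality of the pool on the label sequence `t`: half the difference between the least
information given by the neighbours and the greatest information given by the preceding object and
a non-neighbour. -/
def WorkerPool.memoryQualityAt {τ ℓ : ℕ} (W : WorkerPool τ ℓ) (t : Fin ℓ → Fin τ) : ℝ :=
  (1 / 2) * ((⨅ i : Linked t, mutualInfo (W.meanLaw t) i.1 (neighbors t i.1)) -
    ⨆ x : Rival t, mutualInfo (W.meanLaw t) x.1.1 {x.1.2.1, x.1.2.2})

/-- The memory quality of the pool: the least one over the label sequences for which the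
comparison is not empty. -/
def WorkerPool.memoryQuality {τ ℓ : ℕ} (W : WorkerPool τ ℓ) : ℝ :=
  ⨅ t : {t : Fin ℓ → Fin τ // Nonempty (Rival t)}, W.memoryQualityAt t.1

/-- A universal clustering decoder. With a budget of `N` responses per object, it presents the
objects in `orders N` independent uniformly random orders, each time to `perOrder N` new workers,
and then forms a partition (an equivalence relation) from the orders and the responses. In
`decide N σ Y`, position `p` of the order `a` shows the object `σ a p`, and `Y a b p` is the
answer of the worker `b` of that order at that position. -/
structure UniversalDecoder (τ ℓ : ℕ) where
  orders : ℕ → ℕ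
  perOrder : ℕ → ℕ
  budget : ∀ N, orders N * perOrder N ≤ N
  decide : ∀ N, (Fin (orders N) → Equiv.Perm (Fin ℓ)) →
    (Fin (orders N) → Fin (perOrder N) → Fin ℓ → Response τ) → Setoid (Fin ℓ)

open Classical in
/-- The probability that the decoder with budget `N` does not return the correct clustering, in
which two objects are together exactly if their labels agree, when the labels are independent with
law `P`, and independent workers are drawn from the pool `W`. -/
def UniversalDecoder.errorProb {τ ℓ : ℕ} (Φ : UniversalDecoder τ ℓ) (N : ℕ) (P : Fin τ → ℝ)
    (W : WorkerPool τ ℓ) : ℝ :=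
  ∑ t : Fin ℓ → Fin τ, (∏ i, P (t i)) *
    ∑ σ : Fin (Φ.orders N) → Equiv.Perm (Fin ℓ), (1 / (ℓ.factorial : ℝ)) ^ Φ.orders N *
      ∑ Y : Fin (Φ.orders N) → Fin (Φ.perOrder N) → Fin ℓ → Response τ,
        (∏ a, ∏ b, W.meanLaw (t ∘ σ a) (Y a b)) *
          (if Φ.decide N σ Y = Setoid.ker t then 0 else 1)

/-- The least number of responses per object with which `Φ` has error probability below `ε`, for
all priors and all pools of memory quality at least `θ` (`⊤` if there is none). -/
def UniversalDecoder.samplesNeeded {τ ℓ : ℕ} (Φ : UniversalDecoder τ ℓ) (θ ε : ℝ) : ℕ∞ :=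
  ⨅ (N : ℕ) (_ : ∀ P ∈ stdSimplex ℝ (Fin τ), ∀ W : WorkerPool τ ℓ,
    θ ≤ W.memoryQuality → Φ.errorProb N P W < ε), (N : ℕ∞)

/-- The sample complexity of universal clustering with workers with memory: the minimum over all
universal decoders. -/
def sampleComplexity (τ ℓ : ℕ) (θ ε : ℝ) : ℕ∞ :=
  ⨅ Φ : UniversalDecoder τ ℓ, Φ.samplesNeeded θ ε

/-- The minimum of `1 / (1 - 2 α - β)` and `1 / (1 - 4 α)`, where an expression counts only if its
denominator is positive. -/
def rateExponent (α β : ℝ) : ℝ :=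
  if 2 * α + β < 1 then
    if 4 * α < 1 then min (1 / (1 - 2 * α - β)) (1 / (1 - 4 * α)) else 1 / (1 - 2 * α - β)
  else 1 / (1 - 4 * α)

end CrowdClustering

end

/-!
A vote over few orders, each decoded on its own, needs only `O((log ℓ - log ε) / θ ^ 2)` responses
per object. This gives both bounds: the exponents of the first one satisfy `e ≥ 1` and
`2 / (1 - β) ≥ 2`, and `θ` may be taken bounded, as the memory quality is at most a constant that
depends on `τ` (`le_of_le_memoryQuality`).

**One order.** The decoder compares the estimated informations `I(Y_i; Y_{i-1}, Y_j)` over `j`. If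
position `i` has a parent other than `i - 1`, the parent beats every rival by `2 θ`. Otherwise `Y_i`
is generated from `Y_{i-1}` alone, and all `j` are equally informative
(`mutualInfo_eq_of_not_linked`). So, as soon as the estimates are precise to `θ / 2`, a strict
winner exists exactly at the positions with such a parent, and is the parent
(`faithful_of_close`). The other positions continue a run of the class before them or start a new
class. In the second case the class of `i - 1` usually occurs again later, and the next occurrence
points to `i - 1`, which shows that a run ended there. The two cases are confused only if the last
object of some class comes immediately before the first object of another one
(`eqvGen_joined_iff`). For a random order this has probability `O(τ ^ 2 / ℓ)`
(`card_hiddenBoundary_mul_le`). At the first positions there is no rival to compare with, so an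
order says nothing reliable about the objects at positions `0` and `1`; this adds `O(1 / ℓ)` for a
given pair of objects.

**Precision.** As a function of `√x`, the function `-x log x` is Lipschitz on all of `[0, 1]`
(`abs_negMulLog_sub_le`), and the square root of an empirical frequency is subgaussian at the scale
`1 / √n`, whatever the probability (`mass_sqrt_frequency_le`). Hence `n` of order `log ℓ / θ ^ 2`
workers estimate all the informations precisely, except with probability `1 / ℓ`, without a
logarithm of `θ` being lost.

**The vote.** A pair of objects is misjudged in one order with probability at most `13 τ ^ 2 / ℓ`.
A majority over `k` orders is then wrong with probability at most `(52 τ ^ 2 / ℓ) ^ (k / 2)`, and a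
union bound over the pairs shows that `k` of order `(log ℓ - log ε) / log ℓ` suffices
(`vote_bound_lt`). Neither `k` nor the tolerance used for `n` workers depends on `θ`, and the
product `k n` is of order `(log ℓ - log ε) / θ ^ 2`.
-/

noncomputable section

namespace CrowdClustering

open Finset

/-! ### Finite weighted probability -/

open Classical in
/-- The total weight of a set, when the points of a finite type carry the weights `w`. -/
def mass {Ω : Type*} [Fintype Ω] (w : Ω → ℝ) (S : Set Ω) : ℝ :=
  ∑ x, if x ∈ S then w x else 0

/-- The weight of a sequence of `n` independent draws with weights `w`. -/
def iid {Ω : Type*} (w : Ω → ℝ) (n : ℕ) (Y : Fin n → Ω) : ℝ :=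
  ∏ b, w (Y b)

lemma iid_nonneg {Ω : Type*} {w : Ω → ℝ} (hw : ∀ x, 0 ≤ w x) (n : ℕ) (Y : Fin n → Ω) :
    0 ≤ iid w n Y :=
  prod_nonneg fun _ _ => hw _

open Classical in
lemma prod_ite_mem_eq_pow {Ω : Type*} {n : ℕ} (B : Set Ω) (r : ℝ) (Y : Fin n → Ω) :
    ∏ b, (if Y b ∈ B then r else 1) = r ^ #{b | Y b ∈ B} := by
  rw [prod_ite]; simp

section Mass

variable {Ω : Type*} [Fintype Ω] {w : Ω → ℝ}

lemma mass_nonneg (hw : ∀ x, 0 ≤ w x) (S : Set Ω) : 0 ≤ mass w S :=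
  sum_nonneg fun x _ => by split_ifs <;> simp [hw]

lemma mass_mono (hw : ∀ x, 0 ≤ w x) {S T : Set Ω} (h : S ⊆ T) : mass w S ≤ mass w T := by
  refine sum_le_sum fun x _ => ?_
  by_cases hx : x ∈ S
  · simp [hx, h hx]
  · simp only [hx, if_false]
    split_ifs <;> simp [hw]

lemma mass_union_le (hw : ∀ x, 0 ≤ w x) (S T : Set Ω) :
    mass w (S ∪ T) ≤ mass w S + mass w T := by
  simp only [mass, ← sum_add_distrib]
  refine sum_le_sum fun x _ => ?_
  have := hw x
  by_cases h1 : x ∈ S <;> by_cases h2 : x ∈ T <;> simp [h1, h2, this]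

open Classical in
lemma mass_iUnion_le {ι : Type*} [Fintype ι] (hw : ∀ x, 0 ≤ w x) (S : ι → Set Ω) :
    mass w (⋃ i, S i) ≤ ∑ i, mass w (S i) := by
  simp only [mass]
  rw [sum_comm]
  refine sum_le_sum fun x _ => ?_
  by_cases hx : x ∈ ⋃ i, S i
  · obtain ⟨i, hi⟩ := Set.mem_iUnion.1 hx
    rw [if_pos hx]
    refine le_trans ?_ (single_le_sum (f := fun i => if x ∈ S i then w x else 0)
      (fun j _ => by split_ifs <;> simp [hw]) (mem_univ i))
    simp [hi]
  · rw [if_neg hx]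
    exact sum_nonneg fun j _ => by split_ifs <;> simp [hw]

lemma sum_iid (hw1 : ∑ x, w x = 1) (n : ℕ) : ∑ Y, iid w n Y = 1 := by
  simp only [iid]
  rw [← Fintype.sum_pow, hw1, one_pow]

/-- Markov's inequality for a product of functions of independent draws. -/
lemma mass_iid_le (hw : ∀ x, 0 ≤ w x) {n : ℕ} {g : Ω → ℝ} (hg : ∀ x, 0 ≤ g x)
    {c : ℝ} (hc : 0 ≤ c) {S : Set (Fin n → Ω)}
    (h : ∀ Y ∈ S, (∀ b, w (Y b) ≠ 0) → 1 ≤ c * ∏ b, g (Y b)) :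
    mass (iid w n) S ≤ c * (∑ x, w x * g x) ^ n := by
  rw [Fintype.sum_pow, mul_sum]
  refine sum_le_sum fun Y _ => ?_
  have h0 : 0 ≤ c * ∏ b, w (Y b) * g (Y b) :=
    mul_nonneg hc (prod_nonneg fun b _ => mul_nonneg (hw _) (hg _))
  split_ifs with hY
  · by_cases hz : ∀ b, w (Y b) ≠ 0
    · rw [prod_mul_distrib]
      have h1 := h Y hY hz
      have h2 : 0 ≤ ∏ b, w (Y b) := prod_nonneg fun b _ => hw _
      unfold iid
      nlinarith
    · push Not at hz
      obtain ⟨b, hb⟩ := hz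
      rw [iid, prod_eq_zero (mem_univ b) hb]
      exact h0
  · exact h0

open Classical in
/-- One exponential moment serves both tails of a binomial count: the tilt is the ratio `r` of the
square roots of the aimed and the true frequency, and the exponent is their squared difference. -/
lemma mass_iid_tilt_le (hw : ∀ x, 0 ≤ w x) (hw1 : ∑ x, w x = 1) {n : ℕ} {B : Set Ω} {r : ℝ}
    (hr : 0 < r) {S : Set (Fin n → Ω)}
    (hS : ∀ Y ∈ S, n * (r ^ 2 * mass w B) * Real.log r ≤ #{b | Y b ∈ B} * Real.log r) :
    mass (iid w n) S ≤ Real.exp (-(n * (mass w B * (r - 1) ^ 2))) := by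
  set π := mass w B with hπ
  have hπ0 : 0 ≤ π := mass_nonneg hw B
  have hg : ∀ x : Ω, (0 : ℝ) ≤ (if x ∈ B then r else 1) := fun x => by split_ifs <;> positivity
  have h := mass_iid_le (S := S) hw hg (c := Real.exp (-(n * (r ^ 2 * π) * Real.log r)))
    (Real.exp_pos _).le (fun Y hY _ => by
      rw [prod_ite_mem_eq_pow, ← Real.exp_log (pow_pos hr #{b | Y b ∈ B}), ← Real.exp_add,
        Real.log_pow]
      refine Real.one_le_exp ?_
      linarith [hS Y hY])
  refine h.trans ?_
  have hsum : ∑ x, w x * (if x ∈ B then r else 1) = 1 + π * (r - 1) := by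
    rw [show (1 : ℝ) + π * (r - 1) = ∑ x, w x + π * (r - 1) by rw [hw1], hπ, mass, sum_mul,
      ← sum_add_distrib]
    refine sum_congr rfl fun x _ => ?_
    split_ifs <;> ring
  have hle : ∑ x, w x * (if x ∈ B then r else 1) ≤ Real.exp (π * (r - 1)) := by
    rw [hsum, add_comm]; exact Real.add_one_le_exp _
  have hnn : 0 ≤ ∑ x, w x * (if x ∈ B then r else 1) :=
    sum_nonneg fun x _ => mul_nonneg (hw x) (hg x)
  calc _ ≤ Real.exp (-(n * (r ^ 2 * π) * Real.log r)) * Real.exp (π * (r - 1)) ^ n := by gcongr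
    _ = Real.exp (n * (π * (r - 1)) - n * (r ^ 2 * π) * Real.log r) := by
        rw [← Real.exp_nat_mul, ← Real.exp_add]; ring_nf
    _ ≤ _ := by
        refine Real.exp_le_exp.2 ?_
        have hl : 1 - r⁻¹ ≤ Real.log r := Real.one_sub_inv_le_log_of_pos hr
        have h2 : r ^ 2 * (1 - r⁻¹) = r ^ 2 - r := by field_simp
        have h3 : r ^ 2 - r ≤ r ^ 2 * Real.log r := by
          rw [← h2]; gcongr
        have h4 := mul_le_mul_of_nonneg_left h3 (mul_nonneg (Nat.cast_nonneg (α := ℝ) n) hπ0)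
        nlinarith

open Classical in
/-- The square root of an empirical frequency is subgaussian around the square root of the
probability, at a scale that does not depend on the probability. -/
lemma mass_sqrt_frequency_le (hw : ∀ x, 0 ≤ w x) (hw1 : ∑ x, w x = 1) {n : ℕ} (hn : 0 < n)
    (B : Set Ω) {s : ℝ} (hs : 0 ≤ s) :
    mass (iid w n) {Y | s < |√((#{b | Y b ∈ B} : ℝ) / n) - √(mass w B)|} ≤
      2 * Real.exp (-(n * s ^ 2)) := by
  set π := mass w B with hπ
  have hπ0 : 0 ≤ π := mass_nonneg hw B
  have hnR : (0 : ℝ) < n := by exact_mod_cast hn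
  have hsplit : {Y : Fin n → Ω | s < |√((#{b | Y b ∈ B} : ℝ) / n) - √π|} ⊆
      {Y | √π + s < √((#{b | Y b ∈ B} : ℝ) / n)} ∪
        {Y | √((#{b | Y b ∈ B} : ℝ) / n) < √π - s} := by
    intro Y hY
    rw [Set.mem_ofPred_eq, lt_abs] at hY
    rcases hY with h | h
    · left; simp only [Set.mem_ofPred_eq]; linarith
    · right; simp only [Set.mem_ofPred_eq]; linarith
  refine (mass_mono (iid_nonneg hw n) hsplit).trans
    ((mass_union_le (iid_nonneg hw n) _ _).trans ?_)
  rw [two_mul]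
  rcases hπ0.eq_or_lt with h0 | hpos
  · -- no draw of positive weight lies in `B`, so both tails are null
    rw [← h0]
    refine add_le_add ?_ ?_
    · have := mass_iid_le (S := {Y : Fin n → Ω | √0 + s < √((#{b | Y b ∈ B} : ℝ) / n)}) hw
        (g := fun _ => 1) (fun _ => zero_le_one) (Real.exp_pos (-(n * s ^ 2))).le (by
          intro Y hY hne
          exfalso
          have hzero : ∀ b, Y b ∉ B := by
            intro b hb
            apply hne b
            have h1 : (if Y b ∈ B then w (Y b) else 0) ≤ mass w B :=
              single_le_sum (f := fun x => if x ∈ B then w x else 0)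
                (fun j _ => by split_ifs <;> simp [hw]) (mem_univ (Y b))
            rw [if_pos hb, ← hπ, ← h0] at h1
            exact le_antisymm h1 (hw _)
          simp [hzero] at hY
          linarith)
      simpa [hw1] using this
    · refine le_trans (le_of_eq ?_) (Real.exp_pos _).le
      refine sum_eq_zero fun Y _ => if_neg ?_
      simp only [Set.mem_ofPred_eq, Real.sqrt_zero, not_lt]
      have := Real.sqrt_nonneg ((#{b | Y b ∈ B} : ℝ) / n)
      linarith
  · have hsq : 0 < √π := Real.sqrt_pos.2 hpos
    have hππ : √π ^ 2 = π := Real.sq_sqrt hπ0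
    refine add_le_add ?_ ?_
    · have hr : 0 < (√π + s) / √π := by positivity
      have := mass_iid_tilt_le (S := {Y : Fin n → Ω | √π + s < √((#{b | Y b ∈ B} : ℝ) / n)})
        (B := B) hw hw1 hr (by
          intro Y hY
          have hlog : 0 ≤ Real.log ((√π + s) / √π) :=
            Real.log_nonneg ((one_le_div hsq).2 (by linarith))
          refine mul_le_mul_of_nonneg_right ?_ hlog
          have h1 := (Real.lt_sqrt (by positivity)).1 hY
          rw [lt_div_iff₀ hnR] at h1
          rw [← hπ, div_pow, hππ, div_mul_cancel₀ _ hpos.ne']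
          linarith)
      refine this.trans (le_of_eq ?_)
      congr 2
      rw [← hπ]
      nth_rw 1 [← hππ]
      field_simp
      ring
    · rcases le_or_gt (√π) s with hle | hlt
      · refine le_trans (le_of_eq ?_) (Real.exp_pos _).le
        refine sum_eq_zero fun Y _ => if_neg ?_
        simp only [Set.mem_ofPred_eq, not_lt]
        have := Real.sqrt_nonneg ((#{b | Y b ∈ B} : ℝ) / n)
        linarith
      · have hd : 0 < √π - s := by linarith
        have hr : 0 < (√π - s) / √π := by positivity
        have := mass_iid_tilt_le (S := {Y : Fin n → Ω | √((#{b | Y b ∈ B} : ℝ) / n) < √π - s})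
          (B := B) hw hw1 hr (by
            intro Y hY
            have hlog : Real.log ((√π - s) / √π) ≤ 0 :=
              Real.log_nonpos hr.le ((div_le_one hsq).2 (by linarith))
            refine mul_le_mul_of_nonpos_right ?_ hlog
            have h1 := (Real.sqrt_lt' hd).1 hY
            rw [div_lt_iff₀ hnR] at h1
            rw [← hπ, div_pow, hππ, div_mul_cancel₀ _ hpos.ne']
            linarith)
        refine this.trans (le_of_eq ?_)
        congr 2
        rw [← hπ]
        nth_rw 1 [← hππ]
        field_simp
        ring

open Classical in
/-- A majority of independent votes is wrong with exponentially small probability. -/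
lemma mass_majority_le (hw : ∀ x, 0 ≤ w x) (hw1 : ∑ x, w x = 1) {k : ℕ} {B : Set Ω} {q : ℝ}
    (hq : 0 < q) (hq1 : q ≤ 1) (hB : mass w B ≤ q) :
    mass (iid w k) {Y | k ≤ 2 * #{b | Y b ∈ B}} ≤ (2 * √q) ^ k := by
  have hsq : 0 < √q := Real.sqrt_pos.2 hq
  have hsq1 : √q ≤ 1 := Real.sqrt_le_one.2 hq1
  have hqq : √q ^ 2 = q := Real.sq_sqrt hq.le
  have hg : ∀ x : Ω, (0 : ℝ) ≤ (if x ∈ B then q⁻¹ else 1) := fun x => by split_ifs <;> positivity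
  have h := mass_iid_le (S := {Y : Fin k → Ω | k ≤ 2 * #{b | Y b ∈ B}}) hw hg (c := √q ^ k)
    (by positivity) (fun Y hY _ => by
      have h2 : q⁻¹ ^ #{b | Y b ∈ B} = (√q ^ (2 * #{b | Y b ∈ B}))⁻¹ := by
        rw [pow_mul, hqq, inv_pow]
      rw [prod_ite_mem_eq_pow, h2, ← div_eq_mul_inv, one_le_div (by positivity)]
      exact pow_le_pow_of_le_one hsq.le hsq1 hY)
  refine h.trans ?_
  rw [mul_pow, mul_comm]
  have hsum : ∑ x, w x * (if x ∈ B then q⁻¹ else 1) ≤ 2 := by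
    have h1 : ∀ x, w x * (if x ∈ B then q⁻¹ else 1) ≤ (if x ∈ B then w x else 0) * q⁻¹ + w x := by
      intro x
      have := hw x
      split_ifs <;> simp [this]
    refine (sum_le_sum fun x _ => h1 x).trans ?_
    rw [sum_add_distrib, hw1, ← sum_mul]
    have : mass w B * q⁻¹ ≤ 1 := by
      rw [← div_eq_mul_inv, div_le_one hq]; exact hB
    change mass w B * q⁻¹ + 1 ≤ 2
    linarith
  have hnn : 0 ≤ ∑ x, w x * (if x ∈ B then q⁻¹ else 1) :=
    sum_nonneg fun x _ => mul_nonneg (hw x) (hg x)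
  gcongr

end Mass

/-! ### Laws that generate the coordinates one after the other -/

/-- Replacing a coordinate by a uniformly random value preserves the uniform measure. -/
lemma sum_eq_sum_update {ι R : Type*} [Fintype ι] [DecidableEq ι] [Fintype R] [Nonempty R]
    (i : ι) (g : (ι → R) → ℝ) :
    ∑ y, g y = (Fintype.card R : ℝ)⁻¹ * ∑ y, ∑ v, g (Function.update y i v) := by
  classical
  have hinv : Function.Involutive
      (fun x : (ι → R) × R => (Function.update x.1 i x.2, x.1 i)) := by
    intro x; simp
  have h : ∑ x : (ι → R) × R, g (Function.update x.1 i x.2) = ∑ x : (ι → R) × R, g x.1 :=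
    Fintype.sum_bijective _ hinv.bijective _ _ fun x => rfl
  rw [Fintype.sum_prod_type, Fintype.sum_prod_type] at h
  rw [h]
  have : (Fintype.card R : ℝ) ≠ 0 := by exact_mod_cast Fintype.card_ne_zero
  simp only [sum_const, card_univ, nsmul_eq_mul]
  rw [← mul_sum, inv_mul_cancel_left₀ this]

section Chain

variable {R : Type*} {ℓ : ℕ} {q : Fin ℓ → (Fin ℓ → R) → R → ℝ}

/-- The product of the transition probabilities of the first `m` coordinates of `y`, when `q l y` is
the law of coordinate `l` given the earlier coordinates of `y`. -/
def prefixWeight (q : Fin ℓ → (Fin ℓ → R) → R → ℝ) (m : ℕ) (y : Fin ℓ → R) : ℝ :=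
  ∏ l ∈ univ.filter (fun l : Fin ℓ => (l : ℕ) < m), q l y (y l)

variable [Fintype R] [Nonempty R]

/-- Averaging out coordinate `i` of a partial product of transition probabilities. -/
lemma sum_partial_step (hdep : ∀ i, DependsOn (q i) {l | l < i}) (i : Fin ℓ)
    {f : (Fin ℓ → R) → ℝ} (hf : DependsOn f {l | l < i}) (g : R → ℝ) :
    ∑ y, prefixWeight q (i + 1) y * (f y * g (y i)) =
      (Fintype.card R : ℝ)⁻¹ *
        ∑ y, prefixWeight q i y * (f y * ∑ v, q i y v * g v) := by
  rw [sum_eq_sum_update i]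
  congr 1
  refine sum_congr rfl fun y _ => ?_
  rw [mul_sum, mul_sum]
  refine sum_congr rfl fun v _ => ?_
  have hup : ∀ l : Fin ℓ, l ≠ i → Function.update y i v l = y l := fun l hl =>
    Function.update_of_ne hl _ _
  have h1 : (univ.filter fun l : Fin ℓ => (l : ℕ) < i + 1) =
      insert i (univ.filter fun l : Fin ℓ => (l : ℕ) < i) := by
    ext l; simp only [mem_filter, mem_univ, true_and, mem_insert, Fin.ext_iff]; omega
  have h0 : prefixWeight q (i + 1) (Function.update y i v) =
      q i (Function.update y i v) v * prefixWeight q i (Function.update y i v) := by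
    rw [prefixWeight, h1, prod_insert (by simp), Function.update_self, prefixWeight]
  have h2 : prefixWeight q i (Function.update y i v) = prefixWeight q i y := by
    refine prod_congr rfl fun l hl => ?_
    simp only [mem_filter, mem_univ, true_and] at hl
    have hli : l < i := hl
    rw [hup l hli.ne, hdep l fun m (hm : m < l) => hup m (hm.trans hli).ne]
  have h3 : f (Function.update y i v) = f y := hf fun m (hm : m < i) => hup m hm.ne
  have h4 : q i (Function.update y i v) = q i y := hdep i fun m (hm : m < i) => hup m hm.ne
  rw [h0, h2, h3, h4, Function.update_self]
  ring

/-- Under a sequentially generated law, the later coordinates may be taken uniform when a function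
of the first `m` coordinates is averaged. -/
lemma sum_chain_eq_partial (hdep : ∀ i, DependsOn (q i) {l | l < i})
    (hsum : ∀ i y, ∑ v, q i y v = 1) (d : ℕ) : ∀ (m : ℕ), m + d = ℓ →
    ∀ {f : (Fin ℓ → R) → ℝ}, DependsOn f {l | (l : ℕ) < m} →
    ∑ y, (∏ l, q l y (y l)) * f y =
      (Fintype.card R : ℝ)⁻¹ ^ d * ∑ y, prefixWeight q m y * f y := by
  induction d with
  | zero =>
    intro m hm f _
    have : (univ.filter fun l : Fin ℓ => (l : ℕ) < m) = univ := by
      ext l; simp only [mem_filter, mem_univ, true_and, iff_true]; omega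
    simp only [prefixWeight, this, pow_zero, one_mul]
  | succ d ih =>
    intro m hm f hf
    rw [ih (m + 1) (by omega) (f := f) (fun y y' h => hf fun l hl => h l (Nat.lt_succ_of_lt hl))]
    have h := sum_partial_step hdep (⟨m, by omega⟩ : Fin ℓ) (f := f) hf (fun _ => 1)
    simp only [mul_one, hsum] at h
    rw [h, pow_succ, mul_assoc]

/-- The conditional law of coordinate `i`, given the earlier ones, is `q i`. -/
lemma sum_chain_condition (hdep : ∀ i, DependsOn (q i) {l | l < i})
    (hsum : ∀ i y, ∑ v, q i y v = 1) (i : Fin ℓ) {f : (Fin ℓ → R) → ℝ}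
    (hf : DependsOn f {l | l < i}) (g : R → ℝ) :
    ∑ y, (∏ l, q l y (y l)) * (f y * g (y i)) =
      ∑ y, (∏ l, q l y (y l)) * (f y * ∑ v, q i y v * g v) := by
  obtain ⟨d, hd⟩ : ∃ d, (i : ℕ) + 1 + d = ℓ := ⟨ℓ - (i + 1), by omega⟩
  rw [sum_chain_eq_partial hdep hsum d (i + 1) hd, sum_partial_step hdep i hf,
    sum_chain_eq_partial hdep hsum (d + 1) i (by omega), pow_succ, mul_assoc]
  · intro y y' h
    have hlt : ∀ l : Fin ℓ, l < i → y l = y' l := fun l hl => h l hl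
    simp only [hf hlt, hdep i hlt]
  · intro y y' h
    have hlt : ∀ l : Fin ℓ, l < i → y l = y' l := fun l hl => h l (Nat.lt_succ_of_lt hl)
    simp only [hf hlt, h i (Nat.lt_succ_self _)]

lemma sum_chain (hdep : ∀ i, DependsOn (q i) {l | l < i})
    (hsum : ∀ i y, ∑ v, q i y v = 1) : ∑ y, ∏ l, q l y (y l) = 1 := by
  have h := sum_chain_eq_partial hdep hsum ℓ 0 (by omega) (f := fun _ => 1) (fun _ _ _ => rfl)
  simp only [mul_one, prefixWeight] at h
  rw [h]
  have : (Fintype.card R : ℝ) ≠ 0 := by exact_mod_cast Fintype.card_ne_zero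
  simp [this]

end Chain

/-! ### Entropy as an average of the logarithm of the marginals -/

section Entropy

variable {τ ℓ : ℕ} {p : (Fin ℓ → Response τ) → ℝ}

lemma marginal_nonneg (hp : ∀ y, 0 ≤ p y) (A : Finset (Fin ℓ)) (z : A → Response τ) :
    0 ≤ marginal p A z := sum_nonneg fun y _ => hp y

lemma le_marginal_self (hp : ∀ y, 0 ≤ p y) (A : Finset (Fin ℓ)) (y : Fin ℓ → Response τ) :
    p y ≤ marginal p A (fun a => y a) :=
  single_le_sum (f := p) (fun y _ => hp y) (by simp)

lemma marginal_le_sum (hp : ∀ y, 0 ≤ p y) (A : Finset (Fin ℓ)) (z : A → Response τ) :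
    marginal p A z ≤ ∑ y, p y :=
  sum_le_sum_of_subset_of_nonneg (filter_subset _ _) fun y _ _ => hp y

lemma entropy_eq_sum (p : (Fin ℓ → Response τ) → ℝ) (A : Finset (Fin ℓ)) :
    entropy p A = -∑ y, p y * Real.log (marginal p A fun a => y a) := by
  have h := sum_fiberwise_of_maps_to (s := univ) (t := univ)
    (g := fun (y : Fin ℓ → Response τ) (a : A) => y a) (fun _ _ => mem_univ _)
    (fun y => p y * Real.log (marginal p A fun a => y a))
  rw [← h, entropy, ← sum_neg_distrib]
  refine sum_congr rfl fun z _ => ?_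
  have h1 : ∀ y : Fin ℓ → Response τ, (fun a : A => y a) = z ↔ ∀ a : A, y a = z a := fun y =>
    funext_iff
  have h2 : ∑ y with (fun a : A => y a) = z, p y * Real.log (marginal p A fun a => y a) =
      marginal p A z * Real.log (marginal p A z) := by
    conv_rhs => rw [marginal, sum_mul]
    refine sum_congr (by ext y; simp only [mem_filter, h1]) fun y hy => ?_
    rw [mem_filter] at hy
    have := (h1 y).2 hy.2
    rw [this, marginal]
  rw [h2, Real.negMulLog, neg_mul]

/-- The chain rule for a coordinate that is generated from a single earlier one. -/
lemma entropy_insert_of_condition (hp : ∀ y, 0 ≤ p y) {i h : Fin ℓ} {B : Finset (Fin ℓ)}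
    (hB : ∀ b ∈ B, b < i) (hh : h ∈ B) (κ : Response τ → Response τ → ℝ)
    (hcond : ∀ (f : (Fin ℓ → Response τ) → ℝ) (g : Response τ → ℝ), DependsOn f {l | l < i} →
      ∑ y, p y * (f y * g (y i)) = ∑ y, p y * (f y * ∑ v, κ (y h) v * g v)) :
    entropy p (insert i B) = entropy p B - ∑ y, p y * Real.log (κ (y h) (y i)) := by
  have key : ∀ y : Fin ℓ → Response τ, marginal p (insert i B) (fun a => y a) =
      marginal p B (fun a => y a) * κ (y h) (y i) := by
    intro y
    have h1 := hcond (fun y' => if ∀ b ∈ B, y' b = y b then 1 else 0)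
      (fun v => if v = y i then 1 else 0) (by
        intro y₁ y₂ h12
        have : (∀ b ∈ B, y₁ b = y b) ↔ (∀ b ∈ B, y₂ b = y b) :=
          forall₂_congr fun b hb => by rw [h12 b (hB b hb)]
        simp only [this])
    have e1 : marginal p (insert i B) (fun a => y a) =
        ∑ y', p y' * ((if ∀ b ∈ B, y' b = y b then 1 else 0) * if y' i = y i then 1 else 0) := by
      rw [marginal, sum_filter]
      refine sum_congr rfl fun y' _ => ?_
      simp only [Subtype.forall, mem_insert, forall_eq_or_imp]
      by_cases c1 : y' i = y i <;> by_cases c2 : ∀ b ∈ B, y' b = y b <;> simp [c1, c2]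
    have e2 : marginal p B (fun a => y a) * κ (y h) (y i) =
        ∑ y', p y' * ((if ∀ b ∈ B, y' b = y b then 1 else 0) *
          ∑ v, κ (y' h) v * if v = y i then 1 else 0) := by
      rw [marginal, sum_filter, sum_mul]
      refine sum_congr rfl fun y' _ => ?_
      simp only [Subtype.forall, mul_ite, mul_one, mul_zero, sum_ite_eq', mem_univ, if_true]
      by_cases c2 : ∀ b ∈ B, y' b = y b
      · rw [if_pos c2, if_pos c2, c2 h hh, one_mul]
      · rw [if_neg c2, if_neg c2]; simp
    rw [e1, e2, h1]
  rw [entropy_eq_sum, entropy_eq_sum, ← neg_add', ← sum_add_distrib]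
  congr 1
  refine sum_congr rfl fun y _ => ?_
  rcases (hp y).eq_or_lt with h0 | hpos
  · simp [← h0]
  · have hm := hpos.trans_le (le_marginal_self hp (insert i B) y)
    rw [key y] at hm ⊢
    rw [Real.log_mul (left_ne_zero_of_mul hm.ne') (right_ne_zero_of_mul hm.ne'), mul_add]

end Entropy

/-! ### The response law of a worker with memory -/

section ResponseLaw

variable {τ ℓ : ℕ}

lemma context_dependsOn (u : Fin ℓ → Fin τ) (i : Fin ℓ) :
    DependsOn (fun y => context u y i) {l | l < i} := by
  intro y y' h
  have h' : ∀ l : Fin ℓ, l < i → y l = y' l := fun l hl => h l hl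
  simp only [context]
  split_ifs with h0 h1 h2
  · rfl
  · rw [h' _ (Fin.lt_def.2 (by simp only; omega))]
  · have := (sameBefore u i).max'_mem h1
    rw [h' _ (Fin.lt_def.2 (by simp only; omega)), h' _ (by
      simp only [sameBefore, mem_filter] at this; exact this.2.1)]
  · rw [h' _ (Fin.lt_def.2 (by simp only; omega))]

lemma prob_context_dependsOn (Q : MemoryKernel τ) (u : Fin ℓ → Fin τ) (i : Fin ℓ) :
    DependsOn (fun y => Q.prob (u i) (context u y i)) {l | l < i} := by
  intro y y' h
  have := context_dependsOn u i h
  simp only at this ⊢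
  rw [this]

lemma responseLaw_nonneg (Q : MemoryKernel τ) (u : Fin ℓ → Fin τ) (y : Fin ℓ → Response τ) :
    0 ≤ Q.responseLaw u y :=
  prod_nonneg fun _ _ => (Q.isPmf _ _).1 _

lemma sum_responseLaw (Q : MemoryKernel τ) (u : Fin ℓ → Fin τ) :
    ∑ y, Q.responseLaw u y = 1 :=
  sum_chain (q := fun i y => Q.prob (u i) (context u y i)) (prob_context_dependsOn Q u)
    fun _ _ => (Q.isPmf _ _).2

/-- A position has two neighbours if its class occurred before, and last did so before the
preceding position. -/
lemma neighbors_eq_pair {u : Fin ℓ → Fin τ} {i h r : Fin ℓ} (hi : (h : ℕ) + 1 = i)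
    (hr : r ∈ sameBefore u i) (hmax : ∀ m ∈ sameBefore u i, m ≤ r) :
    neighbors u i = {h, r} := by
  ext k
  simp only [neighbors, mem_filter, mem_univ, true_and, mem_insert, mem_singleton]
  constructor
  · rintro (hk | ⟨hk, hk'⟩)
    · left; ext; omega
    · right; exact le_antisymm (hmax k hk) (hk' r hr)
  · rintro (rfl | rfl)
    · exact .inl hi
    · exact .inr ⟨hr, hmax⟩

/-- At a position with fewer than two neighbours, the response is generated from the preceding one
alone, so that no earlier response adds information to it. -/
lemma mutualInfo_eq_of_not_linked (Q : MemoryKernel τ) {u : Fin ℓ → Fin τ} {i h : Fin ℓ}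
    (hi : (h : ℕ) + 1 = i) (hu : (neighbors u i).card ≠ 2) {j j' : Fin ℓ} (hj : j < i)
    (hj' : j' < i) :
    mutualInfo (Q.responseLaw u) i {h, j} = mutualInfo (Q.responseLaw u) i {h, j'} := by
  have hlt : h < i := Fin.lt_def.2 (by omega)
  obtain ⟨c, hc⟩ : ∃ c : Response τ → Context τ, ∀ y, context u y i = c (y h) := by
    have h0 : (i : ℕ) ≠ 0 := by omega
    have hpred : (⟨(i : ℕ) - 1, by omega⟩ : Fin ℓ) = h := by ext; simp only; omega
    by_cases hne : (sameBefore u i).Nonempty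
    · refine ⟨.repeated, fun y => ?_⟩
      have hm : (sameBefore u i).max' hne = h := by
        by_contra hcon
        apply hu
        rw [neighbors_eq_pair hi ((sameBefore u i).max'_mem hne) fun m hm => le_max' _ m hm]
        exact card_pair (Ne.symm hcon)
      simp [context, h0, hne, hpred, hm]
    · exact ⟨.fresh, fun y => by simp [context, h0, hne, hpred]⟩
  have hcond : ∀ (f : (Fin ℓ → Response τ) → ℝ) (g : Response τ → ℝ),
      DependsOn f {l | l < i} →
      ∑ y, Q.responseLaw u y * (f y * g (y i)) =
        ∑ y, Q.responseLaw u y * (f y * ∑ v, Q.prob (u i) (c (y h)) v * g v) := by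
    intro f g hf
    have := sum_chain_condition (q := fun i y => Q.prob (u i) (context u y i))
      (prob_context_dependsOn Q u) (fun _ _ => (Q.isPmf _ _).2) i hf g
    simp only [hc] at this
    exact this
  have key : ∀ j : Fin ℓ, j < i → mutualInfo (Q.responseLaw u) i {h, j} =
      entropy (Q.responseLaw u) {i} +
        ∑ y, Q.responseLaw u y * Real.log (Q.prob (u i) (c (y h)) (y i)) := by
    intro j hj
    rw [mutualInfo, entropy_insert_of_condition (responseLaw_nonneg Q u) (B := {h, j})
      (by simp [hlt, hj]) (by simp) (fun r => Q.prob (u i) (c r)) hcond]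
    ring
  rw [key j hj, key j' hj']

end ResponseLaw

/-! ### Estimation of the information between responses -/

/-- In terms of the square root of its argument, `negMulLog` is Lipschitz up to the boundary. -/
lemma abs_negMulLog_sub_le {a b : ℝ} (ha0 : 0 ≤ a) (ha1 : a ≤ 1) (hb0 : 0 ≤ b) (hb1 : b ≤ 1) :
    |Real.negMulLog a - Real.negMulLog b| ≤ 4 * |√a - √b| := by
  wlog hab : a ≤ b generalizing a b
  · rw [abs_sub_comm, abs_sub_comm (√a)]
    exact this hb0 hb1 ha0 ha1 (not_le.1 hab).le
  obtain ⟨x, hx0, rfl⟩ : ∃ x, 0 ≤ x ∧ a = x ^ 2 := ⟨√a, Real.sqrt_nonneg _, (Real.sq_sqrt ha0).symm⟩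
  obtain ⟨y, hy0, rfl⟩ : ∃ y, 0 ≤ y ∧ b = y ^ 2 := ⟨√b, Real.sqrt_nonneg _, (Real.sq_sqrt hb0).symm⟩
  have hxy : x ≤ y := (pow_le_pow_iff_left₀ hx0 hy0 two_ne_zero).1 hab
  have hy1 : y ≤ 1 := by nlinarith
  rw [Real.sqrt_sq hx0, Real.sqrt_sq hy0, abs_sub_comm x y, abs_of_nonneg (sub_nonneg.2 hxy)]
  simp only [Real.negMulLog, Real.log_pow, Nat.cast_ofNat]
  rcases hy0.eq_or_lt with rfl | hypos
  · have : x = 0 := le_antisymm hxy hx0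
    simp [this]
  have hly : Real.log y ≤ 0 := Real.log_nonpos hy0 hy1
  have hly' : -(y * Real.log y) ≤ 1 - y := by
    have h := mul_le_mul_of_nonneg_left (Real.one_sub_inv_le_log_of_pos hypos) hy0
    rw [mul_sub, mul_inv_cancel₀ hypos.ne', mul_one] at h
    linarith
  have hfirst : 0 ≤ -((y - x) * (y + x) * Real.log y) ∧
      -((y - x) * (y + x) * Real.log y) ≤ 2 * (y - x) := by
    constructor
    · have : 0 ≤ (y - x) * (y + x) := by nlinarith
      nlinarith
    · have h1 : -((y + x) * Real.log y) ≤ 2 := by nlinarith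
      nlinarith
  rcases hx0.eq_or_lt with rfl | hxpos
  · rw [abs_le]
    constructor <;> nlinarith
  have hsecond : 0 ≤ x ^ 2 * (Real.log y - Real.log x) ∧
      x ^ 2 * (Real.log y - Real.log x) ≤ y - x := by
    have hmono : Real.log x ≤ Real.log y := Real.log_le_log hxpos hxy
    constructor
    · exact mul_nonneg (sq_nonneg x) (sub_nonneg.2 hmono)
    · rw [← Real.log_div hypos.ne' hxpos.ne']
      have h1 : Real.log (y / x) ≤ y / x - 1 := Real.log_le_sub_one_of_pos (by positivity)
      have h2 : x ^ 2 * (y / x - 1) = x * (y - x) := by field_simp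
      have h3 := mul_le_mul_of_nonneg_left h1 (sq_nonneg x)
      rw [h2] at h3
      nlinarith
  rw [abs_le]
  constructor <;> nlinarith

section Accuracy

variable {τ ℓ : ℕ}

/-- The set of the positions in `x`. Repetitions are allowed, so that these are all nonempty sets of
at most three positions. -/
def triple (x : Fin ℓ × Fin ℓ × Fin ℓ) : Finset (Fin ℓ) := {x.1, x.2.1, x.2.2}

/-- The square roots of the probabilities in the marginals of `p` and `p'` on at most three
coordinates differ by at most `s`. -/
def Accurate (s : ℝ) (p p' : (Fin ℓ → Response τ) → ℝ) : Prop :=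
  ∀ (x : Fin ℓ × Fin ℓ × Fin ℓ) (z : triple x → Response τ),
    |√(marginal p' (triple x) z) - √(marginal p (triple x) z)| ≤ s

/-- The empirical law of a sequence of response vectors. -/
def empirical {n : ℕ} (Y : Fin n → Fin ℓ → Response τ) (y : Fin ℓ → Response τ) : ℝ :=
  (#{b | Y b = y} : ℝ) / n

/-- A bound on the number of values that the responses at three positions can take. -/
lemma card_triple_fun_le (x : Fin ℓ × Fin ℓ × Fin ℓ) :
    (Fintype.card (triple x → Response τ) : ℝ) ≤ ((τ : ℝ) + 1) ^ 3 := by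
  have h1 : (triple x).card ≤ 3 := card_le_three
  have h2 : Fintype.card (triple x → Response τ) = (τ + 1) ^ (triple x).card := by simp
  rw [h2]
  push_cast
  exact pow_le_pow_right₀ (by linarith [Nat.cast_nonneg (α := ℝ) τ]) h1

lemma empirical_nonneg {n : ℕ} (Y : Fin n → Fin ℓ → Response τ) (y : Fin ℓ → Response τ) :
    0 ≤ empirical Y y := by unfold empirical; positivity

open Classical in
lemma marginal_empirical {n : ℕ} (Y : Fin n → Fin ℓ → Response τ) (A : Finset (Fin ℓ))
    (z : A → Response τ) {B : Set (Fin ℓ → Response τ)} (hB : B = {y | ∀ a : A, y a = z a}) :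
    marginal (empirical Y) A z = (#{b | Y b ∈ B} : ℝ) / n := by
  unfold marginal empirical
  rw [← sum_div]
  congr 1
  have h := card_eq_sum_card_fiberwise (f := Y) (s := univ.filter fun b => ∀ a : A, Y b a = z a)
    (t := univ.filter fun y => ∀ a : A, y a = z a) (fun b hb => by simpa using hb)
  simp only [hB, Set.mem_ofPred_eq]
  rw [filter_congr_decidable, h]
  push_cast
  refine sum_congr rfl fun y hy => ?_
  simp only [mem_filter, mem_univ, true_and] at hy
  congr 2
  ext b
  simp only [mem_filter, mem_univ, true_and]
  constructor
  · rintro rfl; exact ⟨hy, rfl⟩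
  · exact fun h => h.2

lemma sum_empirical {n : ℕ} (hn : 0 < n) (Y : Fin n → Fin ℓ → Response τ) :
    ∑ y, empirical Y y = 1 := by
  have h := card_eq_sum_card_fiberwise (f := Y) (s := univ) (t := univ) (fun _ _ => by simp)
  unfold empirical
  rw [← sum_div, ← Nat.cast_sum, ← h, card_univ, Fintype.card_fin, div_self]
  exact_mod_cast hn.ne'

lemma marginal_eq_mass (p : (Fin ℓ → Response τ) → ℝ) (A : Finset (Fin ℓ)) (z : A → Response τ) :
    marginal p A z = mass p {y | ∀ a : A, y a = z a} := by
  rw [marginal, mass, sum_filter]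
  refine sum_congr rfl fun y _ => ?_
  simp only [Set.mem_ofPred_eq]
  congr

/-- The probability that the empirical law of `n` workers is not accurate. -/
lemma mass_not_accurate_le {p : (Fin ℓ → Response τ) → ℝ} (hp : ∀ y, 0 ≤ p y)
    (hp1 : ∑ y, p y = 1) {n : ℕ} (hn : 0 < n) {s : ℝ} (hs : 0 ≤ s) :
    mass (iid p n) {Y | ¬ Accurate s p (empirical Y)} ≤
      (ℓ : ℝ) ^ 3 * ((τ : ℝ) + 1) ^ 3 * (2 * Real.exp (-(n * s ^ 2))) := by
  have hw := iid_nonneg hp n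
  have hsub : {Y : Fin n → Fin ℓ → Response τ | ¬ Accurate s p (empirical Y)} ⊆
      ⋃ x : Fin ℓ × Fin ℓ × Fin ℓ, ⋃ z : triple x → Response τ,
        {Y | s < |√(marginal (empirical Y) (triple x) z) - √(marginal p (triple x) z)|} := by
    intro Y hY
    simp only [Accurate, Set.mem_ofPred_eq, not_forall, not_le] at hY
    obtain ⟨x, z, h⟩ := hY
    simp only [Set.mem_iUnion, Set.mem_ofPred_eq]
    exact ⟨x, z, h⟩
  refine (mass_mono hw hsub).trans ((mass_iUnion_le hw _).trans ?_)
  have hx : ∀ x : Fin ℓ × Fin ℓ × Fin ℓ, mass (iid p n) (⋃ z : triple x → Response τ,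
      {Y | s < |√(marginal (empirical Y) (triple x) z) - √(marginal p (triple x) z)|}) ≤
      ((τ : ℝ) + 1) ^ 3 * (2 * Real.exp (-(n * s ^ 2))) := by
    intro x
    refine (mass_iUnion_le hw _).trans ?_
    have hz : ∀ z : triple x → Response τ, mass (iid p n)
        {Y | s < |√(marginal (empirical Y) (triple x) z) - √(marginal p (triple x) z)|} ≤
        2 * Real.exp (-(n * s ^ 2)) := by
      intro z
      obtain ⟨B, hB⟩ : ∃ B : Set (Fin ℓ → Response τ), B = {y | ∀ a : triple x, y a = z a} :=
        ⟨_, rfl⟩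
      simp only [marginal_eq_mass p, ← hB, fun Y : Fin n → _ => marginal_empirical Y _ z hB]
      exact mass_sqrt_frequency_le hp hp1 hn B hs
    refine (sum_le_sum fun z _ => hz z).trans ?_
    rw [sum_const, card_univ, nsmul_eq_mul]
    exact mul_le_mul_of_nonneg_right (card_triple_fun_le x) (by positivity)
  refine (sum_le_sum fun x _ => hx x).trans ?_
  rw [sum_const, card_univ, nsmul_eq_mul]
  simp only [Fintype.card_prod, Fintype.card_fin]
  push_cast
  apply le_of_eq
  ring

variable {p p' : (Fin ℓ → Response τ) → ℝ}

lemma entropy_triple_nonneg (hp : ∀ y, 0 ≤ p y) (hp1 : ∑ y, p y = 1)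
    (x : Fin ℓ × Fin ℓ × Fin ℓ) : 0 ≤ entropy p (triple x) :=
  sum_nonneg fun z _ => Real.negMulLog_nonneg (marginal_nonneg hp _ z)
    (hp1 ▸ marginal_le_sum hp _ z)

lemma entropy_triple_le (hp : ∀ y, 0 ≤ p y) (x : Fin ℓ × Fin ℓ × Fin ℓ) :
    entropy p (triple x) ≤ ((τ : ℝ) + 1) ^ 3 := by
  refine le_trans ?_ (card_triple_fun_le (τ := τ) x)
  rw [entropy, ← card_univ, ← nsmul_one, ← sum_const]
  refine sum_le_sum fun z _ => ?_
  have h0 := marginal_nonneg hp (triple x) z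
  rcases h0.eq_or_lt with h | h
  · rw [← h]; simp
  · have h1 := mul_le_mul_of_nonneg_left (Real.one_sub_inv_le_log_of_pos h) h0
    rw [mul_sub, mul_inv_cancel₀ h.ne', mul_one] at h1
    rw [Real.negMulLog]
    linarith

lemma abs_entropy_triple_sub_le (hp : ∀ y, 0 ≤ p y) (hp1 : ∑ y, p y = 1) (hp' : ∀ y, 0 ≤ p' y)
    (hp1' : ∑ y, p' y = 1) {s : ℝ} (h : Accurate s p p') (hs : 0 ≤ s)
    (x : Fin ℓ × Fin ℓ × Fin ℓ) :
    |entropy p' (triple x) - entropy p (triple x)| ≤ 4 * ((τ : ℝ) + 1) ^ 3 * s := by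
  rw [entropy, entropy, ← sum_sub_distrib]
  refine (abs_sum_le_sum_abs _ _).trans ?_
  have hz : ∀ z : triple x → Response τ,
      |Real.negMulLog (marginal p' (triple x) z) - Real.negMulLog (marginal p (triple x) z)| ≤
        4 * s := fun z =>
    (abs_negMulLog_sub_le (marginal_nonneg hp' _ z) (hp1' ▸ marginal_le_sum hp' _ z)
      (marginal_nonneg hp _ z) (hp1 ▸ marginal_le_sum hp _ z)).trans
      (mul_le_mul_of_nonneg_left (h x z) (by norm_num))
  refine (sum_le_sum fun z _ => hz z).trans ?_
  rw [sum_const, card_univ, nsmul_eq_mul]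
  have := mul_le_mul_of_nonneg_right (card_triple_fun_le (τ := τ) x)
    (mul_nonneg (by norm_num : (0 : ℝ) ≤ 4) hs)
  linarith

lemma mutualInfo_pair_eq (p : (Fin ℓ → Response τ) → ℝ) (i h j : Fin ℓ) :
    mutualInfo p i {h, j} =
      entropy p (triple (i, i, i)) + entropy p (triple (h, h, j)) - entropy p (triple (i, h, j)) := by
  simp [mutualInfo, triple]

lemma abs_mutualInfo_sub_le (hp : ∀ y, 0 ≤ p y) (hp1 : ∑ y, p y = 1) (hp' : ∀ y, 0 ≤ p' y)
    (hp1' : ∑ y, p' y = 1) {s : ℝ} (h : Accurate s p p') (hs : 0 ≤ s) (i k j : Fin ℓ) :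
    |mutualInfo p' i {k, j} - mutualInfo p i {k, j}| ≤ 12 * ((τ : ℝ) + 1) ^ 3 * s := by
  rw [mutualInfo_pair_eq, mutualInfo_pair_eq]
  have h1 := abs_le.1 (abs_entropy_triple_sub_le hp hp1 hp' hp1' h hs (i, i, i))
  have h2 := abs_le.1 (abs_entropy_triple_sub_le hp hp1 hp' hp1' h hs (k, k, j))
  have h3 := abs_le.1 (abs_entropy_triple_sub_le hp hp1 hp' hp1' h hs (i, k, j))
  rw [abs_le]
  constructor <;> linarith [h1.1, h1.2, h2.1, h2.2, h3.1, h3.2]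

lemma mutualInfo_pair_le (hp : ∀ y, 0 ≤ p y) (hp1 : ∑ y, p y = 1) (i k j : Fin ℓ) :
    mutualInfo p i {k, j} ≤ 2 * ((τ : ℝ) + 1) ^ 3 := by
  rw [mutualInfo_pair_eq]
  linarith [entropy_triple_le hp (i, i, i), entropy_triple_le hp (k, k, j),
    entropy_triple_nonneg hp hp1 (i, k, j)]

lemma neg_le_mutualInfo_pair (hp : ∀ y, 0 ≤ p y) (hp1 : ∑ y, p y = 1) (i k j : Fin ℓ) :
    -((τ : ℝ) + 1) ^ 3 ≤ mutualInfo p i {k, j} := by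
  rw [mutualInfo_pair_eq]
  linarith [entropy_triple_nonneg hp hp1 (i, i, i), entropy_triple_nonneg hp hp1 (k, k, j),
    entropy_triple_le hp (i, k, j)]

end Accuracy

/-! ### Clustering from one order -/

section Order

variable {τ ℓ : ℕ}

/-- The position before `i` (and `0` if `i = 0`). -/
def before (i : Fin ℓ) : Fin ℓ := ⟨(i : ℕ) - 1, by omega⟩

/-- `j` is the only position before `i - 1` whose response adds, up to the tolerance `δ`, the most
information about the response at `i` to that of the preceding response. -/
def PointsTo (p : (Fin ℓ → Response τ) → ℝ) (δ : ℝ) (i j : Fin ℓ) : Prop :=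
  j < i ∧ (j : ℕ) + 1 ≠ i ∧ ∀ j' : Fin ℓ, j' < i → (j' : ℕ) + 1 ≠ i → j' ≠ j →
    mutualInfo p i {before i, j'} + δ < mutualInfo p i {before i, j}

/-- The guess that `j` is the most recent position with the class of `i`. A position that points
nowhere is joined to the preceding one, unless that one is pointed to from a later position and so
is the end of a run. -/
def Joined (p : (Fin ℓ → Response τ) → ℝ) (δ : ℝ) (j i : Fin ℓ) : Prop :=
  3 ≤ (i : ℕ) ∧ (PointsTo p δ i j ∨
    ((j : ℕ) + 1 = i ∧ (∀ k, ¬ PointsTo p δ i k) ∧ ∀ m, i < m → ¬ PointsTo p δ m j))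

/-- The pointers at the positions from `3` on are those to the parents that are not the preceding
position. Positions below `3` have no rival to compare a parent with. -/
def Faithful (u : Fin ℓ → Fin τ) (p : (Fin ℓ → Response τ) → ℝ) (δ : ℝ) : Prop :=
  ∀ i j : Fin ℓ, 3 ≤ (i : ℕ) →
    (PointsTo p δ i j ↔ IsGreatest (sameBefore u i : Set (Fin ℓ)) j ∧ (j : ℕ) + 1 ≠ i)

/-- Somewhere the last object of a class comes immediately before the first object of another one.
There the boundary between the two classes cannot be seen. -/
def HiddenBoundary (u : Fin ℓ → Fin τ) : Prop :=
  ∃ h i : Fin ℓ, (h : ℕ) + 1 = i ∧ (∀ k, u k = u i → i ≤ k) ∧ ∀ k, u k = u h → k ≤ h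

lemma mem_sameBefore {u : Fin ℓ → Fin τ} {i k : Fin ℓ} :
    k ∈ sameBefore u i ↔ k < i ∧ u k = u i := by simp [sameBefore]

lemma card_neighbors_ne_two {u : Fin ℓ → Fin τ} {i h : Fin ℓ} (hi : (h : ℕ) + 1 = i)
    (hu : ¬ ∃ r, IsGreatest (sameBefore u i : Set (Fin ℓ)) r ∧ (r : ℕ) + 1 ≠ i) :
    (neighbors u i).card ≠ 2 := by
  have hsub : neighbors u i ⊆ {h} := by
    intro k hk
    simp only [neighbors, mem_filter, mem_univ, true_and] at hk
    rw [mem_singleton]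
    rcases hk with hk | ⟨hk, hk'⟩
    · ext; omega
    · by_contra hne
      exact hu ⟨k, ⟨hk, hk'⟩, fun h' => hne (by ext; omega)⟩
  have := card_le_card hsub
  rw [card_singleton] at this
  omega

/-- Accurate information reveals the parents: at a linked position the parent stands out by the
gap `2 θ`, and at another one all candidates are equally informative. -/
lemma faithful_of_close (Q : MemoryKernel τ) {u : Fin ℓ → Fin τ}
    {p : (Fin ℓ → Response τ) → ℝ} {θ η : ℝ}
    (hclose : ∀ i k j, |mutualInfo p i {k, j} - mutualInfo (Q.responseLaw u) i {k, j}| ≤ η)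
    (hgap : ∀ (i : Linked u) (x : Rival u),
      mutualInfo (Q.responseLaw u) x.1.1 {x.1.2.1, x.1.2.2} + 2 * θ ≤
        mutualInfo (Q.responseLaw u) i.1 (neighbors u i.1)) (hη : 2 * η < θ) :
    Faithful u p (2 * η) := by
  intro i j hi3
  have hb : (before i : ℕ) + 1 = i := by simp only [before]; omega
  have hη0 : 0 ≤ η := (abs_nonneg _).trans (hclose i i i)
  have hstand : ∀ r, IsGreatest (sameBefore u i : Set (Fin ℓ)) r ∧ (r : ℕ) + 1 ≠ i →
      PointsTo p (2 * η) i r := by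
    rintro r ⟨⟨hr, hmax⟩, hri⟩
    have hn := neighbors_eq_pair hb hr hmax
    have hcard : (neighbors u i).card = 2 := by
      rw [hn, card_pair]
      intro h'
      rw [h'] at hb
      exact hri hb
    refine ⟨(mem_sameBefore.1 hr).1, hri, fun j' hj' hj'i hne => ?_⟩
    have h := hgap ⟨i, hcard⟩ ⟨(i, before i, j'), hcard, hb, hj', by
      rw [hn, mem_insert, mem_singleton, not_or]
      exact ⟨fun h' : j' = before i => hj'i (by rw [h']; exact hb), hne⟩⟩
    simp only [hn] at h
    have h1 := (abs_le.1 (hclose i (before i) j')).2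
    have h2 := (abs_le.1 (hclose i (before i) r)).1
    linarith
  refine ⟨fun hp => ?_, hstand j⟩
  by_cases hex : ∃ r, IsGreatest (sameBefore u i : Set (Fin ℓ)) r ∧ (r : ℕ) + 1 ≠ i
  · obtain ⟨r, hr⟩ := hex
    by_cases hjr : j = r
    · rw [hjr]; exact hr
    · exfalso
      have h1 := hp.2.2 r (hstand r hr).1 hr.2 (Ne.symm hjr)
      have h2 := (hstand r hr).2.2 j hp.1 hp.2.1 hjr
      linarith
  · exfalso
    -- from position `3` on there are two candidates before the preceding position
    obtain ⟨j', hj', hj'i, hne⟩ : ∃ j' : Fin ℓ, j' < i ∧ (j' : ℕ) + 1 ≠ i ∧ j' ≠ j := by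
      by_cases h0 : (j : ℕ) = 0
      · exact ⟨⟨1, by omega⟩, Fin.lt_def.2 (by simp only; omega), by simp only; omega,
          fun h' => by rw [← h'] at h0; simp at h0⟩
      · exact ⟨⟨0, by omega⟩, Fin.lt_def.2 (by simp only; omega), by simp only; omega,
          fun h' => by rw [← h'] at h0; simp at h0⟩
    have h1 := hp.2.2 j' hj' hj'i hne
    have h2 := mutualInfo_eq_of_not_linked Q hb (card_neighbors_ne_two hb hex) hj' hp.1
    have h3 := (abs_le.1 (hclose i (before i) j')).1
    have h4 := (abs_le.1 (hclose i (before i) j)).2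
    linarith

/-- With faithful pointers and no hidden boundary, the join is with the parent. -/
lemma joined_iff {u : Fin ℓ → Fin τ} {p : (Fin ℓ → Response τ) → ℝ} {δ : ℝ}
    (hf : Faithful u p δ) (hu : ¬ HiddenBoundary u) {i j : Fin ℓ} (hi : 3 ≤ (i : ℕ)) :
    Joined p δ j i ↔ IsGreatest (sameBefore u i : Set (Fin ℓ)) j := by
  have hb : (before i : ℕ) + 1 = i := by simp only [before]; omega
  have hnone : ∀ m, i < m → 3 ≤ (m : ℕ) := fun m hm => by
    have := Fin.lt_def.1 hm; omega
  constructor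
  · rintro ⟨-, hp | ⟨hj, hno, hlater⟩⟩
    · exact ((hf i j hi).1 hp).1
    · -- a position without parent would be a boundary, visible by a later pointer to `j`
      have hji : j < i := Fin.lt_def.2 (by omega)
      by_cases hne : (sameBefore u i).Nonempty
      · have hg : IsGreatest (sameBefore u i : Set (Fin ℓ)) ((sameBefore u i).max' hne) :=
          isGreatest_max' _ hne
        have : ((sameBefore u i).max' hne : ℕ) + 1 = i := by
          by_contra hcon
          exact hno _ ((hf i _ hi).2 ⟨hg, hcon⟩)
        have hj' : j = (sameBefore u i).max' hne := by ext; omega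
        rw [hj']; exact hg
      · exfalso
        have hfirst : ∀ k, u k = u i → i ≤ k := fun k hk => by
          by_contra hcon
          exact hne ⟨k, mem_sameBefore.2 ⟨not_le.1 hcon, hk⟩⟩
        have hrec : ∃ m, u m = u j ∧ j < m := by
          by_contra hcon
          push Not at hcon
          exact hu ⟨j, i, hj, hfirst, fun k hk => hcon k hk⟩
        have hrec' : (univ.filter fun m => u m = u j ∧ j < m).Nonempty := by
          obtain ⟨m, hm⟩ := hrec
          exact ⟨m, by simpa using hm⟩
        set m := (univ.filter fun m => u m = u j ∧ j < m).min' hrec' with hm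
        have hmem := min'_mem _ hrec'
        rw [← hm] at hmem
        simp only [mem_filter, mem_univ, true_and] at hmem
        have hmi : m ≠ i := by
          intro h'
          have h1 := hfirst j (by rw [← h', hmem.1])
          exact absurd h1 (not_le.2 hji)
        have him : i < m := by
          refine lt_of_le_of_ne (Fin.le_def.2 ?_) (Ne.symm hmi)
          have := Fin.lt_def.1 hmem.2
          omega
        refine hlater m him ((hf m j (hnone m him)).2 ⟨⟨mem_sameBefore.2 ⟨hmem.2, hmem.1.symm⟩,
          fun k hk => ?_⟩, ?_⟩)
        · by_contra hcon
          obtain ⟨hk1, hk2⟩ := mem_sameBefore.1 (mem_coe.1 hk)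
          have := min'_le (univ.filter fun m => u m = u j ∧ j < m) k (by
            simp only [mem_filter, mem_univ, true_and]
            exact ⟨hk2.trans hmem.1, not_le.1 hcon⟩)
          exact absurd hk1 (not_lt.2 this)
        · have := Fin.lt_def.1 him
          omega
  · intro hg
    have hji := (mem_sameBefore.1 (mem_coe.1 hg.1))
    refine ⟨hi, ?_⟩
    by_cases hj : (j : ℕ) + 1 = i
    · refine .inr ⟨hj, fun k hk => ?_, fun m hm hp => ?_⟩
      · have hk' := (hf i k hi).1 hk
        exact hk'.2 (by rw [hk'.1.unique hg]; exact hj)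
      · have hp' := (hf m j (hnone m hm)).1 hp
        have := hp'.1.2 (mem_coe.2 (mem_sameBefore.2
          ⟨hm, hji.2.symm.trans (mem_sameBefore.1 (mem_coe.1 hp'.1.1)).2⟩))
        exact absurd hji.1 (not_lt.2 this)
    · exact .inl ((hf i j hi).2 ⟨hg, hj⟩)

/-- With faithful pointers and no hidden boundary, the joins generate the classes from position `2`
on. -/
lemma eqvGen_joined_iff {u : Fin ℓ → Fin τ} {p : (Fin ℓ → Response τ) → ℝ} {δ : ℝ}
    (hf : Faithful u p δ) (hu : ¬ HiddenBoundary u) {i j : Fin ℓ} (hi : 2 ≤ (i : ℕ))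
    (hj : 2 ≤ (j : ℕ)) : Relation.EqvGen (Joined p δ) i j ↔ u i = u j := by
  constructor
  · intro h
    clear hi hj
    induction h with
    | rel a b hab =>
      exact (mem_sameBefore.1 (mem_coe.1 ((joined_iff hf hu hab.1).1 hab).1)).2
    | refl a => rfl
    | symm a b _ ih => exact ih.symm
    | trans a b c _ _ ih1 ih2 => exact ih1.trans ih2
  · have key : ∀ n : ℕ, ∀ i j : Fin ℓ, (j : ℕ) ≤ n → 2 ≤ (i : ℕ) → i ≤ j → u i = u j →
        Relation.EqvGen (Joined p δ) i j := by
      intro n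
      induction n with
      | zero => intro i j h1 h2 h3; have := Fin.le_def.1 h3; omega
      | succ n ih =>
        intro i j hjn hi hij hc
        rcases hij.eq_or_lt with rfl | hlt
        · exact .refl _
        have hlt' := Fin.lt_def.1 hlt
        have hmem : i ∈ sameBefore u j := mem_sameBefore.2 ⟨hlt, hc⟩
        have hg : IsGreatest (sameBefore u j : Set (Fin ℓ)) ((sameBefore u j).max' ⟨i, hmem⟩) :=
          isGreatest_max' _ _
        set r := (sameBefore u j).max' ⟨i, hmem⟩
        have hr := mem_sameBefore.1 (mem_coe.1 hg.1)
        have hrj := Fin.lt_def.1 hr.1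
        exact .trans _ _ _ (ih i r (by omega) hi (hg.2 hmem) (hc.trans hr.2.symm))
          (.rel _ _ ((joined_iff hf hu (by omega)).2 hg))
    intro hc
    rcases le_total i j with h | h
    · exact key j i j le_rfl hi h hc
    · exact .symm _ _ (key i j i le_rfl hj h hc.symm)

end Order

/-! ### Random orders -/

section Permutations

variable {τ ℓ : ℕ}

/-- A given object is at a given position in at most a fraction `1 / ℓ` of the orders. -/
lemma card_perm_apply_eq_mul_le (p x : Fin ℓ) :
    #{σ : Equiv.Perm (Fin ℓ) | σ p = x} * ℓ ≤ ℓ.factorial := by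
  have h := card_le_card_of_injOn
    (s := (univ.filter fun σ : Equiv.Perm (Fin ℓ) => σ p = x) ×ˢ (univ : Finset (Fin ℓ)))
    (t := (univ : Finset (Equiv.Perm (Fin ℓ)))) (fun z => z.1 * Equiv.swap p z.2)
    (fun _ _ => by simp) (by
      rintro ⟨σ₁, r₁⟩ h₁ ⟨σ₂, r₂⟩ h₂ h
      simp only [coe_product, coe_filter, Set.mem_prod, Set.mem_ofPred_eq, mem_univ,
        true_and] at h₁ h₂
      simp only at h
      have e₁ : (σ₁ * Equiv.swap p r₁) r₁ = x := by simp [h₁.1]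
      have e₂ : (σ₂ * Equiv.swap p r₂) r₂ = x := by simp [h₂.1]
      have hr : r₁ = r₂ := (σ₂ * Equiv.swap p r₂).injective (by rw [e₂, ← h, e₁])
      subst hr
      rw [mul_left_injective _ h])
  simpa [card_product, Fintype.card_perm] using h

/-- In `u`, the last occurrence of `c` is at `h`, the first one of `b` is at `i`, and these are
consecutive positions. -/
def BoundaryAt (u : Fin ℓ → Fin τ) (c b : Fin τ) (h i : Fin ℓ) : Prop :=
  (h : ℕ) + 1 = i ∧ u h = c ∧ u i = b ∧ (∀ k, u k = b → i ≤ k) ∧ ∀ k, u k = c → k ≤ h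

lemma BoundaryAt.lt {u : Fin ℓ → Fin τ} {c b : Fin τ} {h i : Fin ℓ} (H : BoundaryAt u c b h i) :
    h < i := Fin.lt_def.2 (by have := H.1; omega)

lemma BoundaryAt.ne {u : Fin ℓ → Fin τ} {c b : Fin τ} {h i : Fin ℓ} (H : BoundaryAt u c b h i) :
    c ≠ b := by
  rintro rfl
  exact absurd (H.2.2.2.1 h H.2.1) (not_le.2 H.lt)

/-- The last `c` can be found again after it has been moved to the right, to position `r`: it is
the only `c` after the boundary. -/
lemma BoundaryAt.swap_last {u : Fin ℓ → Fin τ} {c b : Fin τ} {h i r : Fin ℓ}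
    (H : BoundaryAt u c b h i) (hr : h < r) :
    (u ∘ Equiv.swap h r) r = c ∧ (∀ k, k ≠ r → (u ∘ Equiv.swap h r) k = c → k < h) ∧
    (u r = b → (u ∘ Equiv.swap h r) h = b ∧ ∀ k, (u ∘ Equiv.swap h r) k = b → h ≤ k) ∧
    (u r ≠ b → (u ∘ Equiv.swap h r) i = b ∧ ∀ k, (u ∘ Equiv.swap h r) k = b → i ≤ k) := by
  obtain ⟨hi, hc, hb, hfirst, hlast⟩ := H
  have hcb := BoundaryAt.ne ⟨hi, hc, hb, hfirst, hlast⟩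
  have hlt : h < i := Fin.lt_def.2 (by omega)
  have hh : (u ∘ Equiv.swap h r) h = u r := by simp
  have hrr : (u ∘ Equiv.swap h r) r = c := by simp [hc]
  have ho : ∀ k, k ≠ h → k ≠ r → (u ∘ Equiv.swap h r) k = u k := fun k h1 h2 => by
    simp [Equiv.swap_apply_of_ne_of_ne h1 h2]
  refine ⟨hrr, fun k hkr hk => ?_, fun hur => ⟨hh.trans hur, fun k hk => ?_⟩,
    fun hur => ⟨?_, fun k hk => ?_⟩⟩
  · by_cases hkh : k = h
    · rw [hkh, hh] at hk
      exact absurd (hlast r hk) (not_le.2 hr)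
    · rw [ho k hkh hkr] at hk
      exact lt_of_le_of_ne (hlast k hk) hkh
  · by_cases hkh : k = h
    · exact hkh.ge
    · by_cases hkr : k = r
      · exact absurd (hrr.symm.trans (hkr ▸ hk)) hcb
      · rw [ho k hkh hkr] at hk
        exact hlt.le.trans (hfirst k hk)
  · rw [ho i hlt.ne' fun h' => hur (h' ▸ hb), hb]
  · by_cases hkh : k = h
    · rw [hkh, hh] at hk
      exact absurd hk hur
    · by_cases hkr : k = r
      · exact absurd (hrr.symm.trans (hkr ▸ hk)) hcb
      · rw [ho k hkh hkr] at hk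
        exact hfirst k hk

/-- The mirror image of `BoundaryAt.swap_last`: the first `b` is moved to the left. -/
lemma BoundaryAt.swap_first {u : Fin ℓ → Fin τ} {c b : Fin τ} {h i r : Fin ℓ}
    (H : BoundaryAt u c b h i) (hr : r < i) :
    (u ∘ Equiv.swap i r) r = b ∧ (∀ k, k ≠ r → (u ∘ Equiv.swap i r) k = b → i < k) ∧
    (u r = c → (u ∘ Equiv.swap i r) i = c ∧ ∀ k, (u ∘ Equiv.swap i r) k = c → k ≤ i) ∧
    (u r ≠ c → (u ∘ Equiv.swap i r) h = c ∧ ∀ k, (u ∘ Equiv.swap i r) k = c → k ≤ h) := by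
  obtain ⟨hi, hc, hb, hfirst, hlast⟩ := H
  have hcb := BoundaryAt.ne ⟨hi, hc, hb, hfirst, hlast⟩
  have hlt : h < i := Fin.lt_def.2 (by omega)
  have hh : (u ∘ Equiv.swap i r) i = u r := by simp
  have hrr : (u ∘ Equiv.swap i r) r = b := by simp [hb]
  have ho : ∀ k, k ≠ i → k ≠ r → (u ∘ Equiv.swap i r) k = u k := fun k h1 h2 => by
    simp [Equiv.swap_apply_of_ne_of_ne h1 h2]
  refine ⟨hrr, fun k hkr hk => ?_, fun hur => ⟨hh.trans hur, fun k hk => ?_⟩,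
    fun hur => ⟨?_, fun k hk => ?_⟩⟩
  · by_cases hkh : k = i
    · rw [hkh, hh] at hk
      exact absurd (hfirst r hk) (not_le.2 hr)
    · rw [ho k hkh hkr] at hk
      exact lt_of_le_of_ne (hfirst k hk) (Ne.symm hkh)
  · by_cases hkh : k = i
    · exact hkh.le
    · by_cases hkr : k = r
      · exact absurd (hrr.symm.trans (hkr ▸ hk)) hcb.symm
      · rw [ho k hkh hkr] at hk
        exact (hlast k hk).trans hlt.le
  · rw [ho h hlt.ne fun h' => hur (h' ▸ hc), hc]
  · by_cases hkh : k = i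
    · rw [hkh, hh] at hk
      exact absurd hk hur
    · by_cases hkr : k = r
      · exact absurd (hrr.symm.trans (hkr ▸ hk)) hcb.symm
      · rw [ho k hkh hkr] at hk
        exact hlast k hk

/-- The move of an object at the boundary between `h` and `i` to position `r`: the object at `h` is
moved to the right, or the one at `i` to the left. -/
def boundaryMove (h i r : Fin ℓ) : Equiv.Perm (Fin ℓ) :=
  if h < r then Equiv.swap h r else Equiv.swap i r

/-- The moved sequence determines the move, up to the direction and to whether the object that gave
way has a class of the boundary. -/
lemma boundaryMove_unique {u₁ u₂ : Fin ℓ → Fin τ} {c b : Fin τ} {h₁ i₁ r₁ h₂ i₂ r₂ : Fin ℓ}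
    (H₁ : BoundaryAt u₁ c b h₁ i₁) (H₂ : BoundaryAt u₂ c b h₂ i₂)
    (hu : u₁ ∘ boundaryMove h₁ i₁ r₁ = u₂ ∘ boundaryMove h₂ i₂ r₂)
    (hdir : h₁ < r₁ ↔ h₂ < r₂) (hb : u₁ r₁ = b ↔ u₂ r₂ = b) (hc : u₁ r₁ = c ↔ u₂ r₂ = c) :
    boundaryMove h₁ i₁ r₁ = boundaryMove h₂ i₂ r₂ ∧ r₁ = r₂ := by
  have hi₁ := H₁.1
  have hi₂ := H₂.1
  by_cases hr₁ : h₁ < r₁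
  · have hr₂ := hdir.1 hr₁
    simp only [boundaryMove, if_pos hr₁, if_pos hr₂] at hu ⊢
    obtain ⟨a₁, b₁, c₁, d₁⟩ := H₁.swap_last hr₁
    obtain ⟨a₂, b₂, c₂, d₂⟩ := H₂.swap_last hr₂
    rw [hu] at a₁ b₁ c₁ d₁
    have hr : r₁ = r₂ := by
      by_contra hne
      have := b₁ r₂ (Ne.symm hne) a₂
      have := b₂ r₁ hne a₁
      omega
    have hh : h₁ = h₂ := by
      by_cases hub : u₁ r₁ = b
      · exact le_antisymm ((c₁ hub).2 _ (c₂ (hb.1 hub)).1) ((c₂ (hb.1 hub)).2 _ (c₁ hub).1)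
      · have hub₂ := fun h => hub (hb.2 h)
        have : i₁ = i₂ := le_antisymm ((d₁ hub).2 _ (d₂ hub₂).1) ((d₂ hub₂).2 _ (d₁ hub).1)
        ext
        omega
    rw [hr, hh]
    exact ⟨rfl, rfl⟩
  · have hr₂ := fun h => hr₁ (hdir.2 h)
    simp only [boundaryMove, if_neg hr₁, if_neg hr₂] at hu ⊢
    obtain ⟨a₁, b₁, c₁, d₁⟩ := H₁.swap_first (r := r₁) (by omega)
    obtain ⟨a₂, b₂, c₂, d₂⟩ := H₂.swap_first (r := r₂) (by omega)
    rw [hu] at a₁ b₁ c₁ d₁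
    have hr : r₁ = r₂ := by
      by_contra hne
      have := b₁ r₂ (Ne.symm hne) a₂
      have := b₂ r₁ hne a₁
      omega
    have hi : i₁ = i₂ := by
      by_cases huc : u₁ r₁ = c
      · exact le_antisymm ((c₂ (hc.1 huc)).2 _ (c₁ huc).1) ((c₁ huc).2 _ (c₂ (hc.1 huc)).1)
      · have huc₂ := fun h => huc (hc.2 h)
        have : h₁ = h₂ := le_antisymm ((d₂ huc₂).2 _ (d₁ huc).1) ((d₁ huc).2 _ (d₂ huc₂).1)
        ext
        omega
    rw [hr, hi]
    exact ⟨rfl, rfl⟩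

open Classical in
/-- In a random order, two given classes have a boundary with probability at most `8 / ℓ`: the moves
of an object at the boundary make `ℓ` orders of one. -/
lemma card_boundary_mul_le (t : Fin ℓ → Fin τ) (c b : Fin τ) :
    #{σ : Equiv.Perm (Fin ℓ) | ∃ h i, BoundaryAt (t ∘ σ) c b h i} * ℓ ≤ 8 * ℓ.factorial := by
  set E := univ.filter fun σ : Equiv.Perm (Fin ℓ) => ∃ h i, BoundaryAt (t ∘ σ) c b h i with hE
  rcases ℓ.eq_zero_or_pos with rfl | hpos
  · simp
  have hch : ∀ σ : Equiv.Perm (Fin ℓ), ∃ z : Fin ℓ × Fin ℓ, σ ∈ E →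
      BoundaryAt (t ∘ σ) c b z.1 z.2 := by
    intro σ
    by_cases hσ : σ ∈ E
    · obtain ⟨h, i, H⟩ := (mem_filter.1 hσ).2
      exact ⟨(h, i), fun _ => H⟩
    · exact ⟨(⟨0, hpos⟩, ⟨0, hpos⟩), fun h => absurd h hσ⟩
  choose z hz using hch
  have h := card_le_card_of_injOn (s := E ×ˢ (univ : Finset (Fin ℓ)))
    (t := (univ : Finset (Equiv.Perm (Fin ℓ) × Bool × Bool × Bool)))
    (fun x => (x.1 * boundaryMove (z x.1).1 (z x.1).2 x.2, decide ((z x.1).1 < x.2),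
      decide (t (x.1 x.2) = b), decide (t (x.1 x.2) = c)))
    (fun _ _ => by simp) (by
      rintro ⟨σ₁, r₁⟩ h₁ ⟨σ₂, r₂⟩ h₂ h
      simp only [coe_product, Set.mem_prod, mem_coe] at h₁ h₂
      simp only [Prod.mk.injEq, decide_eq_decide] at h
      obtain ⟨hσ, hdir, hb, hc⟩ := h
      obtain ⟨hmove, hr⟩ := boundaryMove_unique (hz σ₁ h₁.1) (hz σ₂ h₂.1) (r₁ := r₁) (r₂ := r₂)
        (by
          have := congrArg (fun π : Equiv.Perm (Fin ℓ) => t ∘ π) hσ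
          simpa [Equiv.Perm.coe_mul, Function.comp_assoc] using this) hdir hb hc
      rw [hmove] at hσ
      rw [mul_left_injective _ hσ, hr])
  simp only [card_product, card_univ, Fintype.card_prod, Fintype.card_perm, Fintype.card_fin,
    Fintype.card_bool] at h
  omega

open Classical in
lemma card_hiddenBoundary_mul_le (t : Fin ℓ → Fin τ) :
    #{σ : Equiv.Perm (Fin ℓ) | HiddenBoundary (t ∘ σ)} * ℓ ≤ 8 * τ ^ 2 * ℓ.factorial := by
  have hsub : (univ.filter fun σ : Equiv.Perm (Fin ℓ) => HiddenBoundary (t ∘ σ)) ⊆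
      (univ : Finset (Fin τ × Fin τ)).biUnion fun x =>
        univ.filter fun σ : Equiv.Perm (Fin ℓ) => ∃ h i, BoundaryAt (t ∘ σ) x.1 x.2 h i := by
    intro σ hσ
    obtain ⟨h, i, hi, hfirst, hlast⟩ := (mem_filter.1 hσ).2
    simp only [mem_biUnion, mem_univ, true_and, mem_filter]
    exact ⟨((t ∘ σ) h, (t ∘ σ) i), h, i, hi, rfl, rfl, hfirst, hlast⟩
  calc _ ≤ (∑ x : Fin τ × Fin τ,
        #{σ : Equiv.Perm (Fin ℓ) | ∃ h i, BoundaryAt (t ∘ σ) x.1 x.2 h i}) * ℓ :=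
        Nat.mul_le_mul_right _ ((card_le_card hsub).trans card_biUnion_le)
    _ ≤ ∑ _x : Fin τ × Fin τ, 8 * ℓ.factorial := by
        rw [sum_mul]
        exact sum_le_sum fun x _ => card_boundary_mul_le t x.1 x.2
    _ = 8 * τ ^ 2 * ℓ.factorial := by
        simp only [sum_const, card_univ, Fintype.card_prod, Fintype.card_fin, smul_eq_mul]
        ring

end Permutations

/-! ### Consequences of the memory quality -/

section Quality

variable {τ ℓ : ℕ} {W : WorkerPool τ ℓ}

lemma exists_meanLaw_eq (W : WorkerPool τ ℓ) :
    ∃ Q : MemoryKernel τ, ∀ u : Fin ℓ → Fin τ, W.meanLaw u = Q.responseLaw u := by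
  obtain ⟨Q, hQ⟩ := W.markov_mean
  exact ⟨Q, fun u => funext fun y => hQ u y⟩

lemma meanLaw_nonneg (W : WorkerPool τ ℓ) (u : Fin ℓ → Fin τ) (y : Fin ℓ → Response τ) :
    0 ≤ W.meanLaw u y := by
  obtain ⟨Q, hQ⟩ := exists_meanLaw_eq W
  rw [hQ]
  exact responseLaw_nonneg Q u y

lemma sum_meanLaw (W : WorkerPool τ ℓ) (u : Fin ℓ → Fin τ) : ∑ y, W.meanLaw u y = 1 := by
  obtain ⟨Q, hQ⟩ := exists_meanLaw_eq W
  rw [hQ]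
  exact sum_responseLaw Q u

lemma gap_of_le_memoryQuality {θ : ℝ} (hθ : θ ≤ W.memoryQuality) {u : Fin ℓ → Fin τ}
    (i : Linked u) (x : Rival u) :
    mutualInfo (W.meanLaw u) x.1.1 {x.1.2.1, x.1.2.2} + 2 * θ ≤
      mutualInfo (W.meanLaw u) i.1 (neighbors u i.1) := by
  have h1 : W.memoryQuality ≤ W.memoryQualityAt u :=
    ciInf_le (f := fun t : {t : Fin ℓ → Fin τ // Nonempty (Rival t)} => W.memoryQualityAt t.1)
      (Set.finite_range _).bddBelow ⟨u, ⟨x⟩⟩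
  have h2 := ciInf_le
    (f := fun i : Linked u => mutualInfo (W.meanLaw u) i.1 (neighbors u i.1))
    (Set.finite_range _).bddBelow i
  have h3 := le_ciSup
    (f := fun x : Rival u => mutualInfo (W.meanLaw u) x.1.1 {x.1.2.1, x.1.2.2})
    (Set.finite_range _).bddAbove x
  rw [WorkerPool.memoryQualityAt] at h1
  linarith

/-- The memory quality is bounded by the entropy of three responses. -/
lemma le_of_le_memoryQuality {θ : ℝ} (hθ0 : 0 < θ) (hθ : θ ≤ W.memoryQuality) :
    θ ≤ 2 * ((τ : ℝ) + 1) ^ 3 := by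
  have hne : Nonempty {t : Fin ℓ → Fin τ // Nonempty (Rival t)} := by
    by_contra hcon
    rw [not_nonempty_iff] at hcon
    rw [WorkerPool.memoryQuality, Real.iInf_of_isEmpty] at hθ
    linarith
  obtain ⟨u, ⟨x⟩⟩ := hne
  have h := gap_of_le_memoryQuality hθ ⟨x.1.1, x.2.1⟩ x
  obtain ⟨a, b, hab⟩ := card_eq_two.1 x.2.1
  simp only [hab.2] at h
  have h1 := mutualInfo_pair_le (meanLaw_nonneg W u) (sum_meanLaw W u) x.1.1 a b
  have h2 := neg_le_mutualInfo_pair (meanLaw_nonneg W u) (sum_meanLaw W u) x.1.1 x.1.2.1 x.1.2.2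
  have h3 : (0 : ℝ) ≤ ((τ : ℝ) + 1) ^ 3 := by positivity
  linarith

end Quality

/-! ### The vote over the orders -/

section Vote

variable {τ ℓ : ℕ}

open Classical in
/-- The decoder that uses `k` orders: two objects are joined if the clusterings from the single
orders, with tolerance `δ n` for `n` workers, put them together in more than half of the orders. -/
def voteDecoder (τ ℓ k : ℕ) (δ : ℕ → ℝ) : UniversalDecoder τ ℓ where
  orders _ := k
  perOrder N := N / k
  budget N := Nat.mul_div_le N k
  decide N σ Y := Relation.EqvGen.setoid fun x y =>
    k < 2 * #{a | Relation.EqvGen (Joined (empirical (Y a)) (δ (N / k)))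
      ((σ a).symm x) ((σ a).symm y)}

/-- The probability that an order is `ω.1` and its `n` workers answer `ω.2`. -/
def orderWeight (W : WorkerPool τ ℓ) (t : Fin ℓ → Fin τ) (n : ℕ)
    (ω : Equiv.Perm (Fin ℓ) × (Fin n → Fin ℓ → Response τ)) : ℝ :=
  1 / (ℓ.factorial : ℝ) * iid (W.meanLaw (t ∘ ω.1)) n ω.2

lemma orderWeight_nonneg (W : WorkerPool τ ℓ) (t : Fin ℓ → Fin τ) (n : ℕ)
    (ω : Equiv.Perm (Fin ℓ) × (Fin n → Fin ℓ → Response τ)) : 0 ≤ orderWeight W t n ω :=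
  mul_nonneg (by positivity) (iid_nonneg (meanLaw_nonneg W _) n _)

lemma sum_orderWeight (W : WorkerPool τ ℓ) (t : Fin ℓ → Fin τ) (n : ℕ) :
    ∑ ω, orderWeight W t n ω = 1 := by
  have h : (ℓ.factorial : ℝ) ≠ 0 := by exact_mod_cast ℓ.factorial_ne_zero
  simp only [orderWeight, Fintype.sum_prod_type, ← mul_sum, sum_iid (sum_meanLaw W _)]
  simp [Fintype.card_perm, h]

open Classical in
/-- The weight of an event that concerns the order alone. -/
lemma mass_orderWeight_fst (W : WorkerPool τ ℓ) (t : Fin ℓ → Fin τ) (n : ℕ)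
    (S : Set (Equiv.Perm (Fin ℓ))) :
    mass (orderWeight W t n) {ω | ω.1 ∈ S} = (#{σ | σ ∈ S} : ℝ) / ℓ.factorial := by
  simp only [mass, orderWeight, Fintype.sum_prod_type, Set.mem_ofPred_eq]
  have h : ∀ σ : Equiv.Perm (Fin ℓ), (∑ Y : Fin n → Fin ℓ → Response τ,
      if σ ∈ S then 1 / (ℓ.factorial : ℝ) * iid (W.meanLaw (t ∘ σ)) n Y else 0) =
      if σ ∈ S then 1 / (ℓ.factorial : ℝ) else 0 := by
    intro σ
    split_ifs
    · rw [← mul_sum, sum_iid (sum_meanLaw W _), mul_one]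
    · simp
  simp only [h]
  rw [← sum_filter, sum_const, nsmul_eq_mul, mul_one_div]

/-- The error probability is that of an event for independent pairs of an order and the answers to
it. -/
lemma errorProb_eq (Φ : UniversalDecoder τ ℓ) (N : ℕ) (P : Fin τ → ℝ) (W : WorkerPool τ ℓ) :
    Φ.errorProb N P W = ∑ t : Fin ℓ → Fin τ, (∏ i, P (t i)) *
      mass (iid (orderWeight W t (Φ.perOrder N)) (Φ.orders N))
        {ω | Φ.decide N (fun a => (ω a).1) (fun a => (ω a).2) ≠ Setoid.ker t} := by
  classical
  unfold UniversalDecoder.errorProb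
  refine sum_congr rfl fun t _ => ?_
  congr 1
  rw [mass, ← (Equiv.arrowProdEquivProdArrow (Fin (Φ.orders N)) (fun _ => Equiv.Perm (Fin ℓ))
    (fun _ => Fin (Φ.perOrder N) → Fin ℓ → Response τ)).symm.sum_comp, Fintype.sum_prod_type]
  refine sum_congr rfl fun σ _ => ?_
  rw [mul_sum]
  refine sum_congr rfl fun Y _ => ?_
  simp only [Equiv.arrowProdEquivProdArrow, Equiv.coe_fn_symm_mk, Set.mem_ofPred_eq, iid,
    orderWeight, prod_mul_distrib, prod_const, card_univ, Fintype.card_fin]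
  by_cases h : Φ.decide N σ Y = Setoid.ker t <;> simp [h]

/-- In one order, the comparison of the objects `x` and `y` may fail: the information is
misestimated, the order hides a boundary, or one of the objects comes first or second. -/
def OrderFails (t : Fin ℓ → Fin τ) (n : ℕ) (δ : ℝ) (x y : Fin ℓ) :
    Set (Equiv.Perm (Fin ℓ) × (Fin n → Fin ℓ → Response τ)) :=
  ({ω | ¬ Faithful (t ∘ ω.1) (empirical ω.2) δ} ∪ {ω | ω.1 ∈ {σ : Equiv.Perm (Fin ℓ) | HiddenBoundary (t ∘ σ)}}) ∪
    ({ω | ω.1 ∈ {σ : Equiv.Perm (Fin ℓ) | (σ.symm x : ℕ) < 2}} ∪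
      {ω | ω.1 ∈ {σ : Equiv.Perm (Fin ℓ) | (σ.symm y : ℕ) < 2}})

lemma eqvGen_iff_of_not_orderFails {t : Fin ℓ → Fin τ} {n : ℕ} {δ : ℝ} {x y : Fin ℓ}
    {ω : Equiv.Perm (Fin ℓ) × (Fin n → Fin ℓ → Response τ)} (h : ω ∉ OrderFails t n δ x y) :
    Relation.EqvGen (Joined (empirical ω.2) δ) (ω.1.symm x) (ω.1.symm y) ↔ t x = t y := by
  simp only [OrderFails, Set.mem_union, Set.mem_ofPred_eq, not_or, not_not, not_lt] at h
  have := eqvGen_joined_iff h.1.1 h.1.2 h.2.1 h.2.2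
  simpa using this

open Classical in
/-- The vote is right if, for each pair of objects, fewer than half of the orders fail. -/
lemma voteDecoder_eq_ker {t : Fin ℓ → Fin τ} {k N : ℕ} {δ : ℕ → ℝ}
    (ω : Fin k → Equiv.Perm (Fin ℓ) × (Fin (N / k) → Fin ℓ → Response τ))
    (h : ∀ x y, 2 * #{a | ω a ∈ OrderFails t (N / k) (δ (N / k)) x y} < k) :
    (voteDecoder τ ℓ k δ).decide N (fun a => (ω a).1) (fun a => (ω a).2) = Setoid.ker t := by
  have key : ∀ x y, (k < 2 * #{a | Relation.EqvGen (Joined (empirical (ω a).2) (δ (N / k)))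
      ((ω a).1.symm x) ((ω a).1.symm y)}) ↔ t x = t y := by
    intro x y
    have hxy := h x y
    constructor
    · intro hk
      by_contra hne
      have : (univ.filter fun a => Relation.EqvGen (Joined (empirical (ω a).2) (δ (N / k)))
          ((ω a).1.symm x) ((ω a).1.symm y)) ⊆
          univ.filter fun a => ω a ∈ OrderFails t (N / k) (δ (N / k)) x y := by
        intro a ha
        simp only [mem_filter, mem_univ, true_and] at ha ⊢
        by_contra hcon
        exact hne ((eqvGen_iff_of_not_orderFails hcon).1 ha)
      have := card_le_card this
      omega
    · intro he
      have : (univ.filter fun a => ¬ ω a ∈ OrderFails t (N / k) (δ (N / k)) x y) ⊆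
          univ.filter fun a => Relation.EqvGen (Joined (empirical (ω a).2) (δ (N / k)))
          ((ω a).1.symm x) ((ω a).1.symm y) := by
        intro a ha
        simp only [mem_filter, mem_univ, true_and] at ha ⊢
        exact (eqvGen_iff_of_not_orderFails ha).2 he
      have h1 := card_le_card this
      have h2 := card_filter_add_card_filter_not (s := (univ : Finset (Fin k)))
        (fun a => ω a ∈ OrderFails t (N / k) (δ (N / k)) x y)
      rw [card_univ, Fintype.card_fin] at h2
      omega
  have hr : (fun x y => k < 2 * #{a | Relation.EqvGen (Joined (empirical (ω a).2) (δ (N / k)))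
      ((ω a).1.symm x) ((ω a).1.symm y)}) = (Setoid.ker t).r := by
    funext x y
    exact propext (key x y)
  refine Setoid.ext fun x y => ?_
  change Relation.EqvGen (fun x y => k < 2 * #{a | Relation.EqvGen (Joined (empirical (ω a).2)
    (δ (N / k))) ((ω a).1.symm x) ((ω a).1.symm y)}) x y ↔ _
  rw [hr, Equivalence.eqvGen_iff (Setoid.ker t).iseqv]

open Classical in
lemma card_early_mul_le (x : Fin ℓ) :
    #{σ : Equiv.Perm (Fin ℓ) | (σ.symm x : ℕ) < 2} * ℓ ≤ 2 * ℓ.factorial := by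
  have hsub : (univ.filter fun σ : Equiv.Perm (Fin ℓ) => (σ.symm x : ℕ) < 2) ⊆
      (univ.filter fun p : Fin ℓ => (p : ℕ) < 2).biUnion fun p =>
        univ.filter fun σ : Equiv.Perm (Fin ℓ) => σ p = x := by
    intro σ hσ
    simp only [mem_filter, mem_univ, true_and, mem_biUnion] at hσ ⊢
    exact ⟨σ.symm x, hσ, by simp⟩
  have hcard : #{p : Fin ℓ | (p : ℕ) < 2} ≤ 2 := by
    have := card_le_card_of_injOn (s := univ.filter fun p : Fin ℓ => (p : ℕ) < 2)
      (t := range 2) (fun p => (p : ℕ)) (fun p hp => by simpa using hp)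
      (fun a _ b _ hab => Fin.ext hab)
    simpa using this
  calc _ ≤ (∑ p ∈ univ.filter fun p : Fin ℓ => (p : ℕ) < 2, #{σ : Equiv.Perm (Fin ℓ) | σ p = x}) * ℓ :=
        Nat.mul_le_mul_right _ ((card_le_card hsub).trans card_biUnion_le)
    _ ≤ ∑ p ∈ univ.filter fun p : Fin ℓ => (p : ℕ) < 2, ℓ.factorial := by
        rw [sum_mul]
        exact sum_le_sum fun p _ => card_perm_apply_eq_mul_le p x
    _ ≤ 2 * ℓ.factorial := by
        rw [sum_const, smul_eq_mul]
        exact Nat.mul_le_mul_right _ hcard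

/-- The scale of accuracy of the information estimated from frequencies whose square roots are
accurate up to `s`. -/
def infoError (τ : ℕ) (s : ℝ) : ℝ := 12 * ((τ : ℝ) + 1) ^ 3 * s

/-- A single order fails with probability of the order `τ ^ 2 / ℓ`. -/
lemma mass_orderFails_le {W : WorkerPool τ ℓ} {θ : ℝ} (hθ : θ ≤ W.memoryQuality)
    (hτ : 1 ≤ τ) (hℓ : 0 < ℓ) {n : ℕ} (hn : 0 < n) {s : ℝ} (hs : 0 ≤ s)
    (hsθ : 2 * infoError τ s < θ)
    (hsℓ : (ℓ : ℝ) ^ 3 * ((τ : ℝ) + 1) ^ 3 * (2 * Real.exp (-(n * s ^ 2))) ≤ 1 / ℓ)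
    (t : Fin ℓ → Fin τ) (x y : Fin ℓ) :
    mass (orderWeight W t n) (OrderFails t n (2 * infoError τ s) x y) ≤ 13 * τ ^ 2 / ℓ := by
  classical
  have hw := orderWeight_nonneg W t n
  have hℓR : (0 : ℝ) < ℓ := by exact_mod_cast hℓ
  have hfac : (0 : ℝ) < ℓ.factorial := by exact_mod_cast ℓ.factorial_pos
  obtain ⟨Q, hQ⟩ := exists_meanLaw_eq W
  have hnoise : mass (orderWeight W t n)
      {ω | ¬ Faithful (t ∘ ω.1) (empirical ω.2) (2 * infoError τ s)} ≤ 1 / ℓ := by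
    refine (mass_mono hw (T := {ω | ¬ Accurate s (W.meanLaw (t ∘ ω.1)) (empirical ω.2)})
      ?_).trans ?_
    · intro ω hω hacc
      apply hω
      refine faithful_of_close Q (fun i k j => ?_) (θ := θ) (fun i z => ?_) hsθ
      · rw [← hQ]
        exact abs_mutualInfo_sub_le (meanLaw_nonneg W _) (sum_meanLaw W _) (empirical_nonneg _)
          (sum_empirical hn _) hacc hs i k j
      · rw [← hQ]
        exact gap_of_le_memoryQuality hθ i z
    · have h : ∀ σ : Equiv.Perm (Fin ℓ), (∑ Y : Fin n → Fin ℓ → Response τ,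
          if ¬ Accurate s (W.meanLaw (t ∘ σ)) (empirical Y) then
            1 / (ℓ.factorial : ℝ) * iid (W.meanLaw (t ∘ σ)) n Y else 0) ≤
          1 / (ℓ.factorial : ℝ) * (1 / ℓ) := by
        intro σ
        have := (mass_not_accurate_le (meanLaw_nonneg W (t ∘ σ)) (sum_meanLaw W (t ∘ σ)) hn
          hs).trans hsℓ
        simp only [← mul_ite_zero, ← mul_sum]
        refine mul_le_mul_of_nonneg_left ?_ (by positivity)
        rw [mass] at this
        convert this using 4
      simp only [mass, orderWeight, Fintype.sum_prod_type, Set.mem_ofPred_eq]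
      refine (sum_le_sum fun σ _ => h σ).trans (le_of_eq ?_)
      rw [sum_const, card_univ, Fintype.card_perm, Fintype.card_fin, nsmul_eq_mul,
        ← mul_assoc, mul_one_div_cancel hfac.ne', one_mul]
  have hfrac : ∀ (S : Set (Equiv.Perm (Fin ℓ))) (a : ℕ),
      #{σ | σ ∈ S} * ℓ ≤ a * ℓ.factorial →
      mass (orderWeight W t n) {ω | ω.1 ∈ S} ≤ a / ℓ := by
    intro S a h
    rw [mass_orderWeight_fst, div_le_div_iff₀ hfac hℓR]
    exact_mod_cast h
  have h1 := hfrac {σ : Equiv.Perm (Fin ℓ) | HiddenBoundary (t ∘ σ)} (8 * τ ^ 2) (by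
    simpa using card_hiddenBoundary_mul_le t)
  have h2 : ∀ x : Fin ℓ, _ := fun x =>
    hfrac {σ : Equiv.Perm (Fin ℓ) | (σ.symm x : ℕ) < 2} 2 (by simpa using card_early_mul_le x)
  have hτR : (1 : ℝ) ≤ (τ : ℝ) ^ 2 := by
    have : (1 : ℝ) ≤ τ := by exact_mod_cast hτ
    nlinarith
  have hu := mass_union_le hw
    ({ω | ¬ Faithful (t ∘ ω.1) (empirical ω.2) (2 * infoError τ s)} ∪
      {ω | ω.1 ∈ {σ : Equiv.Perm (Fin ℓ) | HiddenBoundary (t ∘ σ)}})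
    ({ω | ω.1 ∈ {σ : Equiv.Perm (Fin ℓ) | (σ.symm x : ℕ) < 2}} ∪
      {ω | ω.1 ∈ {σ : Equiv.Perm (Fin ℓ) | (σ.symm y : ℕ) < 2}})
  have hu1 := mass_union_le hw
    {ω | ¬ Faithful (t ∘ ω.1) (empirical ω.2) (2 * infoError τ s)}
    {ω | ω.1 ∈ {σ : Equiv.Perm (Fin ℓ) | HiddenBoundary (t ∘ σ)}}
  have hu2 := mass_union_le hw
    {ω | ω.1 ∈ {σ : Equiv.Perm (Fin ℓ) | (σ.symm x : ℕ) < 2}}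
    {ω | ω.1 ∈ {σ : Equiv.Perm (Fin ℓ) | (σ.symm y : ℕ) < 2}}
  have hfin : (1 : ℝ) / ℓ + (8 * τ ^ 2 : ℕ) / ℓ + ((2 : ℕ) / ℓ + (2 : ℕ) / ℓ) ≤
      13 * τ ^ 2 / ℓ := by
    rw [← add_div, ← add_div, ← add_div]
    refine div_le_div_of_nonneg_right ?_ hℓR.le
    push_cast
    linarith
  have hx := h2 x
  have hy := h2 y
  exact hu.trans ((add_le_add (hu1.trans (add_le_add hnoise h1))
    (hu2.trans (add_le_add hx hy))).trans hfin)

/-- The error probability of the vote: a union bound over the pairs of objects. -/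
lemma errorProb_voteDecoder_le {W : WorkerPool τ ℓ} {θ : ℝ} (hθ : θ ≤ W.memoryQuality)
    (hτ : 1 ≤ τ) (hℓ : 0 < ℓ) (hq : 13 * (τ : ℝ) ^ 2 / ℓ ≤ 1) {k N : ℕ} {δ : ℕ → ℝ}
    (hn : 0 < N / k) {s : ℝ} (hs : 0 ≤ s) (hδ : δ (N / k) = 2 * infoError τ s)
    (hsθ : 2 * infoError τ s < θ)
    (hsℓ : (ℓ : ℝ) ^ 3 * ((τ : ℝ) + 1) ^ 3 * (2 * Real.exp (-((N / k : ℕ) * s ^ 2))) ≤ 1 / ℓ)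
    {P : Fin τ → ℝ} (hP : P ∈ stdSimplex ℝ (Fin τ)) :
    (voteDecoder τ ℓ k δ).errorProb N P W ≤
      (ℓ : ℝ) ^ 2 * (2 * √(13 * (τ : ℝ) ^ 2 / ℓ)) ^ k := by
  classical
  rw [errorProb_eq]
  have hbound : ∀ t : Fin ℓ → Fin τ, mass (iid (orderWeight W t (N / k)) k)
      {ω | (voteDecoder τ ℓ k δ).decide N (fun a => (ω a).1) (fun a => (ω a).2) ≠ Setoid.ker t} ≤
      (ℓ : ℝ) ^ 2 * (2 * √(13 * (τ : ℝ) ^ 2 / ℓ)) ^ k := by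
    intro t
    have hw := orderWeight_nonneg W t (N / k)
    have hsub : {ω : Fin k → Equiv.Perm (Fin ℓ) × (Fin (N / k) → Fin ℓ → Response τ) |
        (voteDecoder τ ℓ k δ).decide N (fun a => (ω a).1) (fun a => (ω a).2) ≠ Setoid.ker t} ⊆
        ⋃ x : Fin ℓ × Fin ℓ,
          {ω | k ≤ 2 * #{a | ω a ∈ OrderFails t (N / k) (δ (N / k)) x.1 x.2}} := by
      intro ω hω
      by_contra hcon
      simp only [Set.mem_iUnion, Set.mem_ofPred_eq, not_exists, not_le] at hcon
      exact hω (voteDecoder_eq_ker ω fun x y => hcon (x, y))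
    refine (mass_mono (iid_nonneg hw k) hsub).trans
      ((mass_iUnion_le (iid_nonneg hw k) _).trans ?_)
    have hpos : 0 < 13 * (τ : ℝ) ^ 2 / ℓ := by
      have h1 : (0 : ℝ) < ℓ := by exact_mod_cast hℓ
      have h2 : (0 : ℝ) < τ := by exact_mod_cast hτ
      positivity
    refine (sum_le_sum fun x _ => mass_majority_le hw (sum_orderWeight W t _) hpos hq
      (hδ ▸ mass_orderFails_le hθ hτ hℓ hn hs hsθ hsℓ t x.1 x.2)).trans (le_of_eq ?_)
    rw [sum_const, card_univ, Fintype.card_prod, Fintype.card_fin, nsmul_eq_mul]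
    push_cast
    ring
  have hprod : ∑ t : Fin ℓ → Fin τ, ∏ i, P (t i) = 1 := sum_iid hP.2 ℓ
  calc _ ≤ ∑ t : Fin ℓ → Fin τ, (∏ i, P (t i)) *
        ((ℓ : ℝ) ^ 2 * (2 * √(13 * (τ : ℝ) ^ 2 / ℓ)) ^ k) :=
        sum_le_sum fun t _ => mul_le_mul_of_nonneg_left (hbound t)
          (prod_nonneg fun i _ => hP.1 _)
    _ = _ := by rw [← sum_mul, hprod, one_mul]

end Vote

/-! ### The number of orders and of workers -/

/-- With `k` of the order `(2 log ℓ - log ε) / log ℓ`, the vote has error probability below `ε`.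
The factor `log (52 τ ^ 2) + 1` compares `log ℓ` with `log (ℓ / (52 τ ^ 2))`, which is at least `1`
by the lower bound on `ℓ`. -/
lemma vote_bound_lt {τ ℓ k : ℕ} (hτ : 1 ≤ τ) (hℓ : 150 * τ ^ 2 ≤ ℓ) {ε : ℝ} (hε : 0 < ε)
    (hk : 2 * (Real.log (52 * (τ : ℝ) ^ 2) + 1) * (2 * Real.log ℓ - Real.log ε) <
      k * Real.log ℓ) :
    (ℓ : ℝ) ^ 2 * (2 * √(13 * (τ : ℝ) ^ 2 / ℓ)) ^ k < ε := by
  have hτR : (1 : ℝ) ≤ (τ : ℝ) := by exact_mod_cast hτ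
  have hℓR : 150 * (τ : ℝ) ^ 2 ≤ ℓ := by exact_mod_cast hℓ
  have hM : (1 : ℝ) ≤ 52 * (τ : ℝ) ^ 2 := by nlinarith
  have hMpos : (0 : ℝ) < 52 * (τ : ℝ) ^ 2 := by linarith
  have hℓpos : (0 : ℝ) < ℓ := by nlinarith
  set A := Real.log (52 * (τ : ℝ) ^ 2) with hA
  have hA0 : 0 ≤ A := Real.log_nonneg hM
  have hD : 1 ≤ Real.log ℓ - A := by
    rw [hA, ← Real.log_div hℓpos.ne' hMpos.ne', Real.le_log_iff_exp_le (by positivity),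
      le_div_iff₀ hMpos]
    have := Real.exp_one_lt_d9
    nlinarith
  have hcomp : Real.log ℓ ≤ (A + 1) * (Real.log ℓ - A) := by nlinarith
  have hroot : Real.log (2 * √(13 * (τ : ℝ) ^ 2 / ℓ)) = (A - Real.log ℓ) / 2 := by
    have h4 : 2 * √(13 * (τ : ℝ) ^ 2 / ℓ) = √(52 * (τ : ℝ) ^ 2 / ℓ) := by
      rw [show (52 : ℝ) * (τ : ℝ) ^ 2 / ℓ = 2 ^ 2 * (13 * (τ : ℝ) ^ 2 / ℓ) by ring,
        Real.sqrt_mul (by norm_num), Real.sqrt_sq (by norm_num)]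
    rw [h4, Real.log_sqrt (by positivity), Real.log_div hMpos.ne' hℓpos.ne']
  have hpos : 0 < 2 * √(13 * (τ : ℝ) ^ 2 / ℓ) := by
    have : 0 < 13 * (τ : ℝ) ^ 2 / ℓ := by positivity
    have := Real.sqrt_pos.2 this
    linarith
  rw [← Real.log_lt_log_iff (by positivity) hε, Real.log_mul (by positivity) (by positivity),
    Real.log_pow, Real.log_pow, hroot]
  push_cast
  have hk' : (k : ℝ) * Real.log ℓ ≤ k * ((A + 1) * (Real.log ℓ - A)) :=
    mul_le_mul_of_nonneg_left hcomp (Nat.cast_nonneg k)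
  have h1 : (A + 1) * (2 * (2 * Real.log ℓ - Real.log ε)) <
      (A + 1) * (k * (Real.log ℓ - A)) := by linarith
  have h2 := lt_of_mul_lt_mul_left h1 (by linarith)
  linarith

/-- The square of the accuracy, times the number of workers, that makes all frequencies accurate
with high probability is `noiseFactor τ * log ℓ`. -/
def noiseFactor (τ : ℕ) : ℝ := 4 + Real.log (2 * ((τ : ℝ) + 1) ^ 3)

lemma noiseFactor_pos (τ : ℕ) : 0 < noiseFactor τ := by
  have h : (1 : ℝ) ≤ ((τ : ℝ) + 1) ^ 3 := one_le_pow₀ (by linarith [Nat.cast_nonneg (α := ℝ) τ])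
  have := Real.log_nonneg (show (1 : ℝ) ≤ 2 * ((τ : ℝ) + 1) ^ 3 by linarith)
  unfold noiseFactor
  linarith

lemma noise_bound_le {τ ℓ : ℕ} (hℓ : 1 ≤ Real.log ℓ) :
    (ℓ : ℝ) ^ 3 * ((τ : ℝ) + 1) ^ 3 * (2 * Real.exp (-(noiseFactor τ * Real.log ℓ))) ≤ 1 / ℓ := by
  have hℓpos : (0 : ℝ) < ℓ := by
    rcases Nat.eq_zero_or_pos ℓ with h | h
    · rw [h] at hℓ; norm_num at hℓ
    · exact_mod_cast h
  set M := 2 * ((τ : ℝ) + 1) ^ 3 with hM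
  have hM1 : 1 ≤ M := by
    have : (1 : ℝ) ≤ ((τ : ℝ) + 1) ^ 3 :=
      one_le_pow₀ (by linarith [Nat.cast_nonneg (α := ℝ) τ])
    linarith
  have hlogM := Real.log_nonneg hM1
  have h1 : Real.exp (-(noiseFactor τ * Real.log ℓ)) ≤ Real.exp (-(4 * Real.log ℓ + Real.log M)) := by
    refine Real.exp_le_exp.2 ?_
    rw [noiseFactor, ← hM]
    nlinarith
  have h2 : Real.exp (-(4 * Real.log ℓ + Real.log M)) = ((ℓ : ℝ) ^ 4 * M)⁻¹ := by
    rw [Real.exp_neg, Real.exp_add, Real.exp_log (by linarith)]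
    congr 2
    rw [show (4 : ℝ) * Real.log ℓ = Real.log ((ℓ : ℝ) ^ 4) by rw [Real.log_pow]; norm_num,
      Real.exp_log (by positivity)]
  calc _ = (ℓ : ℝ) ^ 3 * M * Real.exp (-(noiseFactor τ * Real.log ℓ)) := by rw [hM]; ring
    _ ≤ (ℓ : ℝ) ^ 3 * M * ((ℓ : ℝ) ^ 4 * M)⁻¹ := by rw [← h2]; gcongr
    _ = 1 / ℓ := by field_simp

/-- If the number of workers exceeds a multiple of `v / θ ^ 2`, an accuracy of `√(v / n)` estimates
the information to a precision that beats the gap. -/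
lemma two_mul_infoError_lt {τ n : ℕ} {θ v : ℝ} (hθ : 0 < θ) (hv : 0 ≤ v)
    (hn : (2 * infoError τ 1) ^ 2 * v / θ ^ 2 < n) : 2 * infoError τ √(v / n) < θ := by
  have hg : 0 ≤ 2 * infoError τ 1 := by unfold infoError; positivity
  have hn0 : (0 : ℝ) < n := lt_of_le_of_lt (by positivity) hn
  have h1 : 2 * infoError τ √(v / n) = 2 * infoError τ 1 * √(v / n) := by unfold infoError; ring
  rw [h1]
  refine lt_of_pow_lt_pow_left₀ 2 hθ.le ?_
  rw [mul_pow, Real.sq_sqrt (by positivity), ← mul_div_assoc, div_lt_iff₀ hn0]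
  rw [div_lt_iff₀ (by positivity)] at hn
  linarith

/-- The vote needs `O((log ℓ - log ε) / θ ^ 2)` responses per object; and none at all for `θ` so
large that no pool has that memory quality. -/
lemma exists_decoder_samplesNeeded_le (τ : ℕ) (hτ : 1 ≤ τ) :
    ∃ C Θ : ℝ, 0 < C ∧ 1 ≤ Θ ∧ ∀ ℓ : ℕ, 150 * τ ^ 2 ≤ ℓ → ∀ ε : ℝ, 0 < ε → ε < 1 →
      ∃ Φ : UniversalDecoder τ ℓ, ∀ θ : ℝ, 0 < θ →
        (Θ < θ → Φ.samplesNeeded θ ε = 0) ∧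
        (θ ≤ Θ → (Φ.samplesNeeded θ ε : ENNReal) ≤
          ENNReal.ofReal (C * ((Real.log ℓ - Real.log ε) / θ ^ 2))) := by
  have hτR : (1 : ℝ) ≤ (τ : ℝ) := by exact_mod_cast hτ
  set A := Real.log (52 * (τ : ℝ) ^ 2) with hA
  have hA0 : 0 ≤ A := Real.log_nonneg (by nlinarith)
  set Θ := 2 * ((τ : ℝ) + 1) ^ 3 with hΘ
  have hΘ1 : 1 ≤ Θ := by
    have : (1 : ℝ) ≤ ((τ : ℝ) + 1) ^ 3 := one_le_pow₀ (by linarith)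
    linarith
  set B := (2 * infoError τ 1) ^ 2 * noiseFactor τ with hB
  have hB0 : 0 ≤ B := mul_nonneg (sq_nonneg _) (noiseFactor_pos τ).le
  refine ⟨(4 * (A + 1) + 1) * (B + Θ ^ 2), Θ, by positivity, hΘ1, fun ℓ hℓ ε hε hε1 => ?_⟩
  have hℓR : 150 * (τ : ℝ) ^ 2 ≤ ℓ := by exact_mod_cast hℓ
  have hℓ150 : (150 : ℝ) ≤ ℓ := by nlinarith
  have hℓpos : 0 < ℓ := by
    have : (0 : ℝ) < ℓ := by linarith
    exact_mod_cast this
  have hlog : 1 ≤ Real.log ℓ := by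
    rw [Real.le_log_iff_exp_le (by linarith)]
    have := Real.exp_one_lt_d9
    linarith
  have hlogε : Real.log ε < 0 := Real.log_neg hε hε1
  set x := 2 * (A + 1) * (2 * Real.log ℓ - Real.log ε) / Real.log ℓ with hx
  have hx0 : 0 ≤ x := div_nonneg (mul_nonneg (by linarith) (by linarith)) (by linarith)
  set k := ⌊x⌋₊ + 1 with hk
  have hkx : x < k := by rw [hk]; push_cast; exact Nat.lt_floor_add_one x
  have hkx' : (k : ℝ) ≤ x + 1 := by rw [hk]; push_cast; linarith [Nat.floor_le hx0]
  set v := noiseFactor τ * Real.log ℓ with hv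
  have hv0 : 0 ≤ v := mul_nonneg (noiseFactor_pos τ).le (by linarith)
  refine ⟨voteDecoder τ ℓ k fun n => 2 * infoError τ √(v / n), fun θ hθ => ⟨fun hbig => ?_,
    fun hsmall => ?_⟩⟩
  · -- no pool has that quality, so the budget `0` meets the requirement
    refine le_antisymm ?_ zero_le
    refine (iInf₂_le 0 fun P hP W hW => ?_).trans (by simp)
    exact absurd (le_of_le_memoryQuality hθ hW) (not_le.2 hbig)
  · -- the budget `k * n` gives each order `n` workers, just enough for the precision needed
    set n := ⌊(2 * infoError τ 1) ^ 2 * v / θ ^ 2⌋₊ + 1 with hn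
    have hnx : (2 * infoError τ 1) ^ 2 * v / θ ^ 2 < n := by
      rw [hn]; push_cast; exact Nat.lt_floor_add_one _
    have hnx' : (n : ℝ) ≤ (2 * infoError τ 1) ^ 2 * v / θ ^ 2 + 1 := by
      rw [hn]; push_cast; linarith [Nat.floor_le
        (show 0 ≤ (2 * infoError τ 1) ^ 2 * v / θ ^ 2 by positivity)]
    have hkn : k * n / k = n := Nat.mul_div_cancel_left n (by omega)
    have hn0 : (0 : ℝ) < n := by rw [hn]; positivity
    have hsamples : (voteDecoder τ ℓ k fun n => 2 * infoError τ √(v / n)).samplesNeeded θ ε ≤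
        ((k * n : ℕ) : ℕ∞) := by
      refine iInf₂_le (k * n) fun P hP W hW => ?_
      refine (errorProb_voteDecoder_le (s := √(v / n)) hW hτ hℓpos ?_ (by rw [hkn]; omega)
        (Real.sqrt_nonneg _) (by simp only [hkn]) (two_mul_infoError_lt hθ hv0 hnx) ?_ hP).trans_lt
        (vote_bound_lt hτ hℓ hε ?_)
      · rw [div_le_one (by linarith)]
        nlinarith
      · rw [hkn, Real.sq_sqrt (by positivity), mul_div_cancel₀ _ hn0.ne']
        exact noise_bound_le hlog
      · rw [hx, div_lt_iff₀ (by linarith)] at hkx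
        exact hkx
    have hreal : ((k * n : ℕ) : ℝ) ≤
        (4 * (A + 1) + 1) * (B + Θ ^ 2) * ((Real.log ℓ - Real.log ε) / θ ^ 2) := by
      have h1 : (n : ℝ) ≤ (B + Θ ^ 2) * (Real.log ℓ / θ ^ 2) := by
        have h2 : 1 ≤ Θ ^ 2 * Real.log ℓ / θ ^ 2 := by
          rw [le_div_iff₀ (by positivity), one_mul]
          have : θ ^ 2 ≤ Θ ^ 2 := pow_le_pow_left₀ hθ.le hsmall 2
          nlinarith [sq_nonneg Θ]
        have h3 : (B + Θ ^ 2) * (Real.log ℓ / θ ^ 2) =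
            (2 * infoError τ 1) ^ 2 * v / θ ^ 2 + Θ ^ 2 * Real.log ℓ / θ ^ 2 := by
          rw [hB, hv]; ring
        rw [h3]
        linarith
      have h4 : (k : ℝ) * Real.log ℓ ≤ (4 * (A + 1) + 1) * (Real.log ℓ - Real.log ε) := by
        have h5 : x * Real.log ℓ = 2 * (A + 1) * (2 * Real.log ℓ - Real.log ε) :=
          div_mul_cancel₀ _ (by linarith)
        have h6 := mul_le_mul_of_nonneg_right hkx' (by linarith : 0 ≤ Real.log ℓ)
        nlinarith
      push_cast
      calc (k : ℝ) * n ≤ k * ((B + Θ ^ 2) * (Real.log ℓ / θ ^ 2)) := by gcongr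
        _ = (B + Θ ^ 2) * (k * Real.log ℓ) / θ ^ 2 := by ring
        _ ≤ (B + Θ ^ 2) * ((4 * (A + 1) + 1) * (Real.log ℓ - Real.log ε)) / θ ^ 2 := by gcongr
        _ = _ := by ring
    calc _ ≤ (((k * n : ℕ) : ℕ∞) : ENNReal) := ENat.toENNReal_mono hsamples
      _ = ENNReal.ofReal ((k * n : ℕ) : ℝ) := by
        rw [ENNReal.ofReal_natCast, ENat.toENNReal_coe]
      _ ≤ _ := ENNReal.ofReal_le_ofReal hreal

lemma one_le_rateExponent {α β : ℝ} (hα : 0 < α) (hβ : 0 < β)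
    (h : 2 * α + β < 1 ∨ 4 * α < 1) : 1 ≤ rateExponent α β := by
  have h1 : 2 * α + β < 1 → 1 ≤ 1 / (1 - 2 * α - β) := fun h =>
    (one_le_div (by linarith)).2 (by linarith)
  have h2 : 4 * α < 1 → 1 ≤ 1 / (1 - 4 * α) := fun h =>
    (one_le_div (by linarith)).2 (by linarith)
  unfold rateExponent
  split_ifs with c1 c2
  · exact le_min (h1 c1) (h2 c2)
  · exact h1 c1
  · exact h2 (h.resolve_left c1)

end CrowdClustering

end

theorem mainTheorem7 :
    ∃ K : ℕ, ∀ τ : ℕ, 1 ≤ τ →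
      (∀ α β : ℝ, 0 < α → α < 1 / 2 → 0 < β → β < 1 → (2 * α + β < 1 ∨ 4 * α < 1) →
        ∃ C : ℝ, 0 < C ∧ ∀ ℓ : ℕ, K * τ ^ 2 ≤ ℓ → ∀ ε : ℝ, 0 < ε → ε < 1 →
          ∃ Φ : CrowdClustering.UniversalDecoder τ ℓ, ∀ θ : ℝ, 0 < θ →
            CrowdClustering.sampleComplexity τ ℓ θ ε ≤ Φ.samplesNeeded θ ε ∧
            (Φ.samplesNeeded θ ε : ENNReal) ≤ ENNReal.ofReal
              (C * ((Real.log ℓ - Real.log ε) ^ CrowdClustering.rateExponent α β /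
                θ ^ (2 / (1 - β))))) ∧
      (∃ C : ℝ, 0 < C ∧ ∀ ε : ℝ, 0 < ε → ε < 1 → ∃ ℓ₀ : ℕ, ∀ ℓ : ℕ, ℓ₀ ≤ ℓ →
          ∃ Φ : CrowdClustering.UniversalDecoder τ ℓ, ∀ θ : ℝ, 0 < θ →
            CrowdClustering.sampleComplexity τ ℓ θ ε ≤ Φ.samplesNeeded θ ε ∧
            (Φ.samplesNeeded θ ε : ENNReal) ≤ ENNReal.ofReal
              (C * (Real.log ℓ / θ ^ 2))) := by
  refine ⟨150, fun τ hτ => ?_⟩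
  obtain ⟨C, Θ, hC, hΘ, hmain⟩ := CrowdClustering.exists_decoder_samplesNeeded_le τ hτ
  have hlarge : ∀ ℓ : ℕ, 150 * τ ^ 2 ≤ ℓ → 1 ≤ Real.log ℓ := by
    intro ℓ hℓ
    have h1 : 150 ≤ ℓ := by nlinarith
    have h2 : (150 : ℝ) ≤ ℓ := by exact_mod_cast h1
    rw [Real.le_log_iff_exp_le (by linarith)]
    have := Real.exp_one_lt_d9
    linarith
  constructor
  · intro α β hα _ hβ hβ1 hαβ
    have he := CrowdClustering.one_le_rateExponent hα hβ hαβ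
    set e := CrowdClustering.rateExponent α β
    set d := 2 / (1 - β) with hd
    have hd2 : 2 ≤ d := by
      rw [hd, le_div_iff₀ (by linarith)]
      linarith
    refine ⟨C * Θ ^ (d - 2), mul_pos hC (Real.rpow_pos_of_pos (by linarith) _),
      fun ℓ hℓ ε hε hε1 => ?_⟩
    obtain ⟨Φ, hΦ⟩ := hmain ℓ hℓ ε hε hε1
    refine ⟨Φ, fun θ hθ => ⟨iInf_le _ Φ, ?_⟩⟩
    rcases lt_or_ge Θ θ with hbig | hsmall
    · rw [(hΦ θ hθ).1 hbig]
      simp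
    · refine ((hΦ θ hθ).2 hsmall).trans (ENNReal.ofReal_le_ofReal ?_)
      have hL : 1 ≤ Real.log ℓ - Real.log ε := by
        linarith [hlarge ℓ hℓ, Real.log_neg hε hε1]
      have h1 : Real.log ℓ - Real.log ε ≤ (Real.log ℓ - Real.log ε) ^ e := by
        conv_lhs => rw [← Real.rpow_one (Real.log ℓ - Real.log ε)]
        exact Real.rpow_le_rpow_of_exponent_le hL he
      -- as `θ ≤ Θ`, the larger power of `θ` costs only a constant factor
      have h2 : θ ^ d ≤ Θ ^ (d - 2) * θ ^ 2 := by
        have h3 : θ ^ d = θ ^ (d - 2) * θ ^ 2 := by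
          rw [← Real.rpow_natCast θ 2, ← Real.rpow_add hθ]
          norm_num
        rw [h3]
        exact mul_le_mul_of_nonneg_right (Real.rpow_le_rpow hθ.le hsmall (by linarith))
          (sq_nonneg θ)
      have hθd : 0 < θ ^ d := Real.rpow_pos_of_pos hθ _
      rw [mul_assoc]
      refine mul_le_mul_of_nonneg_left ?_ hC.le
      rw [← mul_div_assoc, div_le_div_iff₀ (by positivity) hθd]
      calc _ ≤ (Real.log ℓ - Real.log ε) ^ e * (Θ ^ (d - 2) * θ ^ 2) :=
            mul_le_mul h1 h2 hθd.le (by linarith)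
        _ = _ := by ring
  · refine ⟨2 * C, by linarith, fun ε hε hε1 => ⟨max (150 * τ ^ 2) ⌈ε⁻¹⌉₊, fun ℓ hℓ => ?_⟩⟩
    have hℓ' : 150 * τ ^ 2 ≤ ℓ := (le_max_left _ _).trans hℓ
    have hℓε : ε⁻¹ ≤ ℓ := (Nat.le_ceil _).trans (by exact_mod_cast (le_max_right _ _).trans hℓ)
    have hlogε : -Real.log ε ≤ Real.log ℓ := by
      rw [← Real.log_inv]
      exact Real.log_le_log (by positivity) hℓε
    obtain ⟨Φ, hΦ⟩ := hmain ℓ hℓ' ε hε hε1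
    refine ⟨Φ, fun θ hθ => ⟨iInf_le _ Φ, ?_⟩⟩
    rcases lt_or_ge Θ θ with hbig | hsmall
    · rw [(hΦ θ hθ).1 hbig]
      simp
    · refine ((hΦ θ hθ).2 hsmall).trans (ENNReal.ofReal_le_ofReal ?_)
      rw [show 2 * C * (Real.log ℓ / θ ^ 2) = C * (2 * Real.log ℓ / θ ^ 2) by ring]
      refine mul_le_mul_of_nonneg_left ?_ hC.le
      gcongr
      linarith
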